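/- \textbf{Setting.} Let $V$ be a set of users and let $E'\subseteq V\times V$ be a finite set of candidate links, $(i,j)\in E'$ meaning that user $j$ may become a follower of broadcaster $i$. Let $V'$ be the set of followers $j$ that occur in $E'$. Broadcaster $i$ posts stories at the points of a Poisson process on $(0,\infty)$ with intensity function $\mu_i(t)$, and the feed of user $j$ receives stories through the already existing links at the points of a Poisson process on $(0,\infty)$ with intensity function $\gamma_j(t)$. For each $j\in V'$, the existing feed process of $j$ and the post processes of the broadcasters $i$ with $(i,j)\in E'$ are mutually independent. If a set of links $S\subseteq E'$ is added, then the feed of $j$ also contains all posts of the broadcasters $i$ with $(i,j)\in S$, and its intensity is $$\gamma_j^S(t)=\gamma_j(t)+\sum_{i:(i,j)\in S}\mu_i(t).$$ Feeds list the most recent stories first. Fix an integer $K\ge 1$ and a time window $[t_0,t_f]$ with $0\le t_0<t_f$. Let $r_S(t,i,j)$ be the number of stories posted by $i$ during $(0,t]$ that are among the top $K$ positions of the feed of $j$ at time $t$ once the links $S$ are added. The average top $K$ visibility is the set function on subsets of $E'$ $$F(S)=\sum_{j\in V'}\ \sum_{i:(i,j)\in S}\ \int_{t_0}^{t_f}\mathbb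 E\big[r_S(t,i,j)\big]\,dt .$$ A function $F$ on the subsets of a finite set $W$ is \emph{$\alpha$-submodular} if $$F(A\cup\{v\})-F(A)\ \ge\ (1-\alpha)\big(F(B\cup\{v\})-F(B)\big)\qquad\text{for all } v\in W,\ A\subseteq B\subseteq W,$$ and its \emph{generalized curvature} is the smallest $\alpha\le 1$ for which it is $\alpha$-submodular. \textbf{Assumptions.} Let $\zeta>0$, $\rho>0$ and $\xi$ be real numbers such that: \begin{itemize} \item[(i)] the feed intensities are $\xi$-bounded: for all $j\in V'$ and $S\subseteq E'$, $\ \sup_{(0,t_f)}\gamma_j^S\le \xi\,\inf_{(0,t_f)}\gamma_j^S$; \item[(ii)] for every $(i,j)\in E'$ and every $t\in(0,t_f)$, $\ \rho\sqrt{K-1}\;\mu_i(t)\le \gamma_j(t)$; \item[(iii)] for every $j\in V'$, $\ \int_0^{t_0}\gamma_j(x)\,dx\ \ge\ K-1+\zeta\sqrt{K-1}$. \end{itemize} \textbf{Proposition.} For every $\zeta>0$ there is a constant $c>0$, depending only on $\zeta$, such that in every such setting $F$ is $\alpha^*$-submodular with $$\alpha^*=1-\frac{c}{\xi^2}\,\max\Big\{\frac1{\sqrt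 K},\ \min\{\rho,1\}\,e^{-1/\rho^2}\Big\},$$ and, unless $F$ is constant, the generalized curvature $\alpha$ of $F$ exists and satisfies $\alpha\le\alpha^*$. Moreover, if $\rho\ge 1$, then the same holds with $\alpha^*=1-c/\xi^2$. -/

import Mathlib

open MeasureTheory ProbabilityTheory Set
open scoped NNReal

/-! ### Generalized curvature of a set function -/

/-- The set function `F` on the subsets of the ground set `W` is `α`-submodular:
`F(A ∪ {v}) - F(A) ≥ (1 - α) (F(B ∪ {v}) - F(B))` for all `v ∈ W` and `A ⊆ B ⊆ W`. -/
def IsAlphaSubmodular {L : Type*} [DecidableEq L] (W : Finset L) (F : Finset L → ℝ)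
    (α : ℝ) : Prop :=
  ∀ v ∈ W, ∀ A B : Finset L, A ⊆ B → B ⊆ W →
    (1 - α) * (F (insert v B) - F B) ≤ F (insert v A) - F A

/-- `α` is the generalized curvature of `F`: the smallest number `α ≤ 1` such that
`F` is `α`-submodular. -/
def IsGeneralizedCurvature {L : Type*} [DecidableEq L] (W : Finset L) (F : Finset L → ℝ)
    (α : ℝ) : Prop :=
  IsLeast {a : ℝ | a ≤ 1 ∧ IsAlphaSubmodular W F a} α

/-- The generalized curvature of `F` is at most `a`: `F` is `a`-submodular and, unless `F` is
constant on the subsets of `W` (so that every `α ≤ 1` is admissible and there is no smallest one),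
the generalized curvature exists and is at most `a`. -/
def CurvatureAtMost {L : Type*} [DecidableEq L] (W : Finset L) (F : Finset L → ℝ)
    (a : ℝ) : Prop :=
  IsAlphaSubmodular W F a ∧
    ((∃ S ⊆ W, F S ≠ F ∅) → ∃ α : ℝ, IsGeneralizedCurvature W F α ∧ α ≤ a)

/-! ### Post processes -/

/-- The number of points of `N` in the time interval `(a, b]`. -/
noncomputable def postCount (N : Set ℝ) (a b : ℝ) : ℕ := (N ∩ Ioc a b).ncard

/-- The counting process `t ↦ #(N ∩ (0, t])` of a random set of times `N`. -/
noncomputable def countingProcess {Ω : Type*} (N : Ω → Set ℝ) (t : ℝ≥0) (ω : Ω) : ℕ :=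
  postCount (N ω) 0 t

/-- The random set of times `N` is, on `(0, ∞)`, a Poisson process with (deterministic, possibly
time-varying) intensity `lam`: it is locally finite, the numbers of points in successive time
intervals are independent, and the number of points in `(a, b]` has the Poisson distribution with
mean `∫ x in a..b, lam x`. -/
structure IsPoissonProcess {Ω : Type*} [MeasurableSpace Ω] (P : Measure Ω)
    (N : Ω → Set ℝ) (lam : ℝ → ℝ) : Prop where
  intensity_nonneg : ∀ t, 0 ≤ t → 0 ≤ lam t
  intensity_integrable : ∀ t, 0 ≤ t → IntervalIntegrable lam volume 0 t
  locallyFinite : ∀ ω (t : ℝ), (N ω ∩ Ioc 0 t).Finite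
  measurable_count : ∀ t, Measurable (countingProcess N t)
  indepIncrements : HasIndepIncrements (countingProcess N) P
  law_count : ∀ a b : ℝ, 0 ≤ a → a ≤ b →
    HasLaw (fun ω => postCount (N ω) a b) (poissonMeasure (∫ x in a..b, lam x).toNNReal) P

/-! ### Visibility

A link is a pair `(i, j)`: broadcaster `i`, follower `j`. `post i ω` is the set of times at which
broadcaster `i` posts, and `feed j ω` is the set of times at which user `j` receives the stories of
the broadcasters that she already follows through the existing links. -/

/-- The links of `S` that point at follower `j`. -/
def linksTo {V : Type*} [DecidableEq V] (S : Finset (V × V)) (j : V) : Finset (V × V) :=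
  S.filter (fun e => e.2 = j)

/-- The number of stories that enter the feed of `j` during `(τ, t]` once the links `S` are
added. -/
noncomputable def storiesDuring {V Ω : Type*} [DecidableEq V] (post feed : V → Ω → Set ℝ)
    (S : Finset (V × V)) (j : V) (τ t : ℝ) (ω : Ω) : ℕ :=
  postCount (feed j ω) τ t + ∑ e ∈ linksTo S j, postCount (post e.1 ω) τ t

/-- `r(t, i, j)`: the number of stories posted by `i` up to time `t` that are among the top `K`
positions of the feed of `j` at time `t`, when the feed lists the most recent stories first and
the links `S` have been added. A story posted at time `τ` is in the top `K` when fewer than `K`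
stories entered the feed during `(τ, t]`. -/
noncomputable def topStories {V Ω : Type*} [DecidableEq V] (K : ℕ) (post feed : V → Ω → Set ℝ)
    (S : Finset (V × V)) (i j : V) (t : ℝ) (ω : Ω) : ℕ :=
  {τ : ℝ | τ ∈ post i ω ∧ τ ∈ Ioc 0 t ∧ storiesDuring post feed S j τ t ω < K}.ncard

/-- The average top `K` visibility of broadcaster `i` with respect to follower `j` over the time
window `[t₀, t_f]`, when the links `S` have been added. -/
noncomputable def linkVisibility {V Ω : Type*} [DecidableEq V] [MeasurableSpace Ω]
    (P : Measure Ω) (K : ℕ) (t₀ t_f : ℝ) (post feed : V → Ω → Set ℝ)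
    (S : Finset (V × V)) (i j : V) : ℝ :=
  ∫ t in t₀..t_f, ∫ ω, (topStories K post feed S i j t ω : ℝ) ∂P

/-- The followers occurring in the set `E'` of candidate links. -/
def followers {V : Type*} [DecidableEq V] (E' : Finset (V × V)) : Finset V :=
  E'.image Prod.snd

/-- `F(S)`: the average top `K` visibility of the broadcasters with respect to the followers that
they gain through the links `S ⊆ E'`. -/
noncomputable def averageVisibility {V Ω : Type*} [DecidableEq V] [MeasurableSpace Ω]
    (P : Measure Ω) (K : ℕ) (t₀ t_f : ℝ) (post feed : V → Ω → Set ℝ)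
    (E' S : Finset (V × V)) : ℝ :=
  ∑ j ∈ followers E', ∑ e ∈ linksTo S j, linkVisibility P K t₀ t_f post feed S e.1 j

/-! ### Assumptions on the intensities -/

/-- The intensity of the feed of `j` once the links `S` are added: the intensity `γ j` due to the
existing links plus the intensities of the broadcasters gained through `S`. -/
def feedIntensity {V : Type*} [DecidableEq V] (μ γ : V → ℝ → ℝ) (S : Finset (V × V)) (j : V)
    (t : ℝ) : ℝ :=
  γ j t + ∑ e ∈ linksTo S j, μ e.1 t

/-- `lam` is `ξ`-bounded on the time interval `(0, T)`: its supremum is at most `ξ` times its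
infimum. -/
def XiBounded (ξ T : ℝ) (lam : ℝ → ℝ) : Prop :=
  ∀ s ∈ Ioo 0 T, ∀ t ∈ Ioo 0 T, lam s ≤ ξ * lam t

/-- The post processes that can reach the feed of `j`: the stories that `j` receives through the
existing links (`none`), and the posts of each broadcaster that has a candidate link to `j`. -/
def sourcesOf {V Ω : Type*} (post feed : V → Ω → Set ℝ) (E' : Finset (V × V)) (j : V) :
    Option {i : V // (i, j) ∈ E'} → Ω → Set ℝ
  | none => feed j
  | some i => post i.1

/-! Write `Q` for the Poisson distribution function at `K - 1` and `w` for the corresponding Poisson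
weight, so `Q' = -w`. A story of rate `μ_i(x)` is still in the top `K` at time `t` with probability
`Q(∫ₓᵗ γ_j^S)`. Summing over the added links gives `∫₀ᵗ (f - g) Q(∫ₓᵗ f)` with `g = γ_j`, `f =
γ_j^S`: a functional `visibilityRate` that sees `S` only through `f` (`integral_topStories`,
`visibilityRate_eq_sum`).

Differentiate it at `f` in a direction `m ≥ 0`. Integration by parts
(`integral_mul_deriv_poissonCDF_tail`) removes the negative part and leaves `(∫ m) Q(∫ f) + ∫ g
w(∫ₓᵗ f) (∫ₓᵗ m)`. This is nonnegative, so `F` is monotone.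

To compare the derivatives at `f_A ≤ f_B`, the weight `w` is a nuisance because it is not monotone.
By `ξ`-boundedness there is `p ∈ [0, 1]` with `p f_B ≤ g ≤ ξ² p f_B`. Replacing `g` by a multiple of
`f_B` above, and of `f_A` below, allows integrating by parts backwards, so that only the antitone
`Q` remains. Hence the derivative at `f_B` is at most `ξ²` times that at `f_A`
(`visibilityRateDeriv_le`). Integrating along `f + s m` and over the time window gives the same
factor for marginal gains of `F`, so `F` is `(1 - 1/ξ²)`-submodular, which implies both claimed
bounds with `c = 1`. -/

/-! ### Existence and bound of the generalized curvature. -/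

/-- A set function whose marginal gains are nonnegative and which is `a`-submodular for some
`a ≤ 1` has generalized curvature at most `a`. -/
theorem IsAlphaSubmodular.curvatureAtMost {L : Type*} [DecidableEq L] {W : Finset L}
    {F : Finset L → ℝ} {a : ℝ} (h : IsAlphaSubmodular W F a) (ha : a ≤ 1) :
    CurvatureAtMost W F a := by
  refine ⟨h, fun ⟨S, hSW, hS⟩ => ?_⟩
  have hmono : ∀ v ∈ W, ∀ B ⊆ W, 0 ≤ F (insert v B) - F B := by
    intro v hv B hB
    have h1 := h v hv B B subset_rfl hB
    -- At `B ∪ {v}` the gain of `v` is zero, so submodularity bounds every gain below by zero.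
    have h2 := h v hv B (insert v B) (Finset.subset_insert v B)
      (Finset.insert_subset hv hB)
    rw [Finset.insert_idem] at h2
    simpa using h2
  obtain ⟨v, hv, B, hB, hpos⟩ : ∃ v ∈ W, ∃ B ⊆ W, 0 < F (insert v B) - F B := by
    by_contra! hcon
    refine hS ?_
    clear hS
    induction S using Finset.induction_on with
    | empty => rfl
    | insert v S _ ih =>
      have hv := hSW (Finset.mem_insert_self v S)
      have hS' : S ⊆ W := (Finset.subset_insert v S).trans hSW
      have h1 := hcon v hv S hS'
      have h2 := hmono v hv S hS'
      have h3 := ih hS'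
      linarith
  -- A strictly positive gain compared with itself forces `b ≥ 0`. The admissible set is also
  -- closed, so its infimum is attained.
  have hbdd : BddBelow {b : ℝ | b ≤ 1 ∧ IsAlphaSubmodular W F b} := by
    refine ⟨0, fun b hb => ?_⟩
    have h1 := hb.2 v hv B B subset_rfl hB
    by_contra! hb0
    nlinarith
  have hclosed : IsClosed {b : ℝ | b ≤ 1 ∧ IsAlphaSubmodular W F b} := by
    simp only [IsAlphaSubmodular, ofPred_and, ofPred_forall]
    refine isClosed_Iic.inter ?_
    refine isClosed_iInter fun v => isClosed_iInter fun _ => isClosed_iInter fun A =>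
      isClosed_iInter fun B => isClosed_iInter fun _ => isClosed_iInter fun _ => ?_
    exact isClosed_le (by fun_prop) continuous_const
  exact ⟨_, hclosed.isLeast_csInf ⟨a, ha, h⟩ hbdd, csInf_le hbdd ⟨ha, h⟩⟩

/-! ### The Poisson distribution function as a smooth function of the mean. -/

/-- The distribution function at `n` of the Poisson distribution with mean `l`. -/
noncomputable def poissonCDF (n : ℕ) (l : ℝ) : ℝ :=
  ∑ k ∈ Finset.range (n + 1), Real.exp (-l) * l ^ k / k.factorial

theorem contDiff_poissonCDF (n : ℕ) {k : WithTop ℕ∞} : ContDiff ℝ k (poissonCDF n) := by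
  unfold poissonCDF
  fun_prop

theorem continuous_poissonCDF (n : ℕ) : Continuous (poissonCDF n) :=
  (contDiff_poissonCDF n (k := 0)).continuous

/-- The derivatives of the successive Poisson weights telescope, so only minus the top weight
survives. -/
theorem hasDerivAt_poissonCDF (n : ℕ) (l : ℝ) :
    HasDerivAt (poissonCDF n) (-(Real.exp (-l) * l ^ n / n.factorial)) l := by
  induction n with
  | zero =>
    have : poissonCDF 0 = fun l => Real.exp (-l) := by ext; simp [poissonCDF]
    rw [this]
    simpa using (hasDerivAt_neg l).exp
  | succ n ih =>
    have : poissonCDF (n + 1) =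
        fun l => poissonCDF n l + Real.exp (-l) * l ^ (n + 1) / (n + 1).factorial := by
      ext; simp [poissonCDF, Finset.sum_range_succ]
    rw [this]
    have h1 := (((hasDerivAt_neg l).exp).mul (hasDerivAt_pow (n + 1) l)).div_const
      ((n + 1).factorial : ℝ)
    convert! ih.add h1 using 1
    have : (n.factorial : ℝ) ≠ 0 := by positivity
    rw [Nat.factorial_succ]
    push_cast
    field_simp
    simp

theorem poissonCDF_nonneg (n : ℕ) {l : ℝ} (hl : 0 ≤ l) : 0 ≤ poissonCDF n l :=
  Finset.sum_nonneg fun _ _ => by positivity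

theorem antitoneOn_poissonCDF (n : ℕ) : AntitoneOn (poissonCDF n) (Ici 0) := by
  refine antitoneOn_of_deriv_nonpos (convex_Ici 0) (continuous_poissonCDF n).continuousOn
    (fun x _ => (hasDerivAt_poissonCDF n x).differentiableAt.differentiableWithinAt) ?_
  intro x hx
  rw [interior_Ici] at hx
  rw [(hasDerivAt_poissonCDF n x).deriv]
  have := hx.out
  simp only [Left.neg_nonpos_iff]
  positivity

theorem poissonCDF_le_one (n : ℕ) {l : ℝ} (hl : 0 ≤ l) : poissonCDF n l ≤ 1 := by
  have h := antitoneOn_poissonCDF n self_mem_Ici hl hl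
  refine h.trans ?_
  rw [poissonCDF, Finset.sum_range_succ', Finset.sum_eq_zero] <;> simp

/-! ### Absolutely continuous tails and integration by parts. -/

/-- Intensities are merely integrable, so tails `∫ₓᵗ f` are only absolutely continuous; this carries
that regularity through `poissonCDF`. The set `s` is there because `poissonCDF` is Lipschitz only
locally. -/
theorem AbsolutelyContinuousOnInterval.comp_lipschitzOnWith {f g : ℝ → ℝ} {a b : ℝ} {C : ℝ≥0}
    {s : Set ℝ} (hf : AbsolutelyContinuousOnInterval f a b) (hg : LipschitzOnWith C g s)
    (hs : MapsTo f (uIcc a b) s) : AbsolutelyContinuousOnInterval (fun x => g (f x)) a b := by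
  unfold AbsolutelyContinuousOnInterval at hf ⊢
  refine squeeze_zero' (Filter.Eventually.of_forall fun _ => Finset.sum_nonneg fun _ _ => dist_nonneg)
    ?_ (by simpa using hf.const_mul (C : ℝ))
  rw [Filter.eventually_inf_principal]
  filter_upwards with ⟨n, I⟩ hI
  rw [Finset.mul_sum]
  refine Finset.sum_le_sum fun i hi => ?_
  exact hg.dist_le_mul _ (hs (hI.1 i hi).1) _ (hs (hI.1 i hi).2)

section Tail

variable {t : ℝ} {f m g : ℝ → ℝ}

theorem absolutelyContinuousOnInterval_tail (hf : IntervalIntegrable f volume 0 t) :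
    AbsolutelyContinuousOnInterval (fun x => ∫ y in x..t, f y) 0 t := by
  have h := (IntervalIntegrable.absolutelyContinuousOnInterval_intervalIntegral (c := t) hf
    (by simp)).neg
  have h' : (fun x => ∫ y in x..t, f y) = -fun x => ∫ y in t..x, f y := by
    ext x
    exact intervalIntegral.integral_symm _ _
  rwa [h']

theorem ae_hasDerivAt_tail (hf : IntervalIntegrable f volume 0 t) :
    ∀ᵐ x, x ∈ uIcc 0 t → HasDerivAt (fun x => ∫ y in x..t, f y) (-f x) x := by
  filter_upwards [hf.ae_hasDerivAt_integral] with x hx hxt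
  have := (hx hxt t (by simp)).neg
  refine this.congr_of_eventuallyEq (Filter.Eventually.of_forall fun y => ?_)
  exact intervalIntegral.integral_symm _ _

/-- Integration by parts for `x ↦ P(Poisson(∫ₓᵗ f) ≤ n)` and `x ↦ ∫ₓᵗ m`. -/
theorem integral_mul_deriv_poissonCDF_tail (n : ℕ) (hf : IntervalIntegrable f volume 0 t)
    (hm : IntervalIntegrable m volume 0 t) :
    ∫ x in 0..t, f x * (Real.exp (-∫ y in x..t, f y) * (∫ y in x..t, f y) ^ n / n.factorial) *
        (∫ y in x..t, m y) =
      (∫ x in 0..t, m x * poissonCDF n (∫ y in x..t, f y)) -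
        (∫ x in 0..t, m x) * poissonCDF n (∫ x in 0..t, f x) := by
  have hF := absolutelyContinuousOnInterval_tail hf
  have hM := absolutelyContinuousOnInterval_tail hm
  have hQF : AbsolutelyContinuousOnInterval (fun x => poissonCDF n (∫ y in x..t, f y)) 0 t := by
    obtain ⟨D, hD⟩ := hF.exists_bound
    obtain ⟨C, hC⟩ := (contDiff_poissonCDF n (k := 1)).contDiffOn.exists_lipschitzOnWith
      (by decide) (convex_Icc (-D) D) isCompact_Icc
    exact hF.comp_lipschitzOnWith hC fun x hx => abs_le.1 (hD x hx)
  have h := hM.integral_mul_deriv_eq_deriv_mul hQF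
  -- The boundary term at `t` vanishes since `∫ₜᵗ m = 0`; the one at `0` survives.
  simp only [intervalIntegral.integral_same, zero_mul, zero_sub] at h
  have h1 : ∫ x in 0..t, (∫ y in x..t, m y) * deriv (fun x => poissonCDF n (∫ y in x..t, f y)) x =
      ∫ x in 0..t, f x * (Real.exp (-∫ y in x..t, f y) * (∫ y in x..t, f y) ^ n / n.factorial) *
        (∫ y in x..t, m y) := by
    refine intervalIntegral.integral_congr_ae ?_
    filter_upwards [ae_hasDerivAt_tail hf] with x hx hxt
    have := ((hasDerivAt_poissonCDF n _).comp x (hx (uIoc_subset_uIcc hxt))).deriv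
    rw [Function.comp_def] at this
    rw [this]
    ring
  have h2 : ∫ x in 0..t, deriv (fun x => ∫ y in x..t, m y) x * poissonCDF n (∫ y in x..t, f y) =
      - ∫ x in 0..t, m x * poissonCDF n (∫ y in x..t, f y) := by
    rw [← intervalIntegral.integral_neg]
    refine intervalIntegral.integral_congr_ae ?_
    filter_upwards [ae_hasDerivAt_tail hm] with x hx hxt
    rw [(hx (uIoc_subset_uIcc hxt)).deriv]
    ring
  rw [h1, h2] at h
  rw [h]
  ring

end Tail

/-! ### The visibility functional, its derivative and the comparison of gains. -/

/-- The expected number of points of a Poisson process of intensity `f - g` among the last `n + 1`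
points before time `t` of a Poisson process of intensity `f`. -/
noncomputable def visibilityRate (n : ℕ) (t : ℝ) (g f : ℝ → ℝ) : ℝ :=
  ∫ x in 0..t, (f x - g x) * poissonCDF n (∫ y in x..t, f y)

/-- The derivative of `visibilityRate n t g` at `f` in the direction `m`. -/
noncomputable def visibilityRateDeriv (n : ℕ) (t : ℝ) (g f m : ℝ → ℝ) : ℝ :=
  (∫ x in 0..t, m x) * poissonCDF n (∫ x in 0..t, f x) +
    ∫ x in 0..t, g x *
      ((Real.exp (-∫ y in x..t, f y) * (∫ y in x..t, f y) ^ n / n.factorial) * ∫ y in x..t, m y)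

section

variable {n : ℕ} {t : ℝ} {f g m fA fB : ℝ → ℝ}

theorem continuousOn_tail (hf : IntervalIntegrable f volume 0 t) :
    ContinuousOn (fun x => ∫ y in x..t, f y) (uIcc 0 t) :=
  (absolutelyContinuousOnInterval_tail hf).continuousOn

theorem tail_nonneg (hf : ∀ x ∈ Ioo 0 t, 0 ≤ f x) {x : ℝ} (hx : x ∈ Icc 0 t) :
    0 ≤ ∫ y in x..t, f y := by
  refine intervalIntegral.integral_nonneg_of_ae_restrict hx.2 ?_
  rw [← restrict_Ioo_eq_restrict_Icc]
  filter_upwards [ae_restrict_mem measurableSet_Ioo] with y hy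
  exact hf y ⟨hx.1.trans_lt hy.1, hy.2⟩

theorem intervalIntegrable_tail (hf : IntervalIntegrable f volume 0 t) {x : ℝ}
    (hx : x ∈ Icc 0 t) : IntervalIntegrable f volume x t :=
  hf.mono_set (by rw [uIcc_of_le hx.2, uIcc_of_le (hx.1.trans hx.2)]; exact Icc_subset_Icc_left hx.1)

theorem tail_mono (hf : IntervalIntegrable f volume 0 t) (hg : IntervalIntegrable g volume 0 t)
    (h : ∀ x ∈ Ioo 0 t, f x ≤ g x) {x : ℝ} (hx : x ∈ Icc 0 t) :
    ∫ y in x..t, f y ≤ ∫ y in x..t, g y :=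
  intervalIntegral.integral_mono_on_of_le_Ioo hx.2 (intervalIntegrable_tail hf hx)
    (intervalIntegrable_tail hg hx) fun y hy => h y ⟨hx.1.trans_lt hy.1, hy.2⟩

theorem continuousOn_poissonCDF_tail (hf : IntervalIntegrable f volume 0 t) :
    ContinuousOn (fun x => poissonCDF n (∫ y in x..t, f y)) (uIcc 0 t) :=
  (continuous_poissonCDF n).comp_continuousOn (continuousOn_tail hf)

theorem continuousOn_poissonWeight_tail (hf : IntervalIntegrable f volume 0 t)
    (hm : IntervalIntegrable m volume 0 t) :
    ContinuousOn (fun x => (Real.exp (-∫ y in x..t, f y) * (∫ y in x..t, f y) ^ n / n.factorial) *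
      ∫ y in x..t, m y) (uIcc 0 t) := by
  have h1 := continuousOn_tail hf
  have h2 := continuousOn_tail hm
  fun_prop

/-- In the form obtained after integration by parts no difference is left: all factors are
nonnegative. -/
theorem visibilityRateDeriv_nonneg (ht : 0 ≤ t) (hg : ∀ x ∈ Ioo 0 t, 0 ≤ g x)
    (hf : ∀ x ∈ Ioo 0 t, 0 ≤ f x) (hm : ∀ x ∈ Ioo 0 t, 0 ≤ m x) :
    0 ≤ visibilityRateDeriv n t g f m := by
  have h0 : (0 : ℝ) ∈ Icc 0 t := ⟨le_rfl, ht⟩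
  refine add_nonneg (mul_nonneg (tail_nonneg hm h0) (poissonCDF_nonneg n (tail_nonneg hf h0))) ?_
  refine tail_nonneg (fun x hx => ?_) h0
  have h1 := tail_nonneg hf (Ioo_subset_Icc_self hx)
  have h2 := tail_nonneg hm (Ioo_subset_Icc_self hx)
  have h3 := hg x hx
  positivity

/-- A nonnegative `ξ`-bounded function divided by a `ξ`-bounded function above it is comparable to
a constant. -/
theorem exists_ratio_bounds {ξ : ℝ} (ht : 0 < t) (hξ : 1 ≤ ξ) (hg : ∀ x ∈ Ioo 0 t, 0 ≤ g x)
    (hgf : ∀ x ∈ Ioo 0 t, g x ≤ f x) (hgb : XiBounded ξ t g) (hfb : XiBounded ξ t f) :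
    ∃ p : ℝ, 0 ≤ p ∧ p ≤ 1 ∧ ∀ x ∈ Ioo 0 t, p * f x ≤ g x ∧ g x ≤ ξ ^ 2 * (p * f x) := by
  have hne : ((fun x => g x / f x) '' Ioo 0 t).Nonempty := (nonempty_Ioo.2 ht).image _
  have hf : ∀ x ∈ Ioo 0 t, 0 ≤ f x := fun x hx => (hg x hx).trans (hgf x hx)
  have hbdd : BddBelow ((fun x => g x / f x) '' Ioo 0 t) :=
    ⟨0, forall_mem_image.2 fun x hx => div_nonneg (hg x hx) (hf x hx)⟩
  obtain ⟨x₀, hx₀⟩ := nonempty_Ioo.2 ht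
  -- Take `p = inf g / f`. Where `f` vanishes so does `g`, and the quotient is `0` by convention.
  refine ⟨sInf ((fun x => g x / f x) '' Ioo 0 t), ?_, ?_, fun x hx => ?_⟩
  · exact le_csInf hne (forall_mem_image.2 fun x hx => div_nonneg (hg x hx) (hf x hx))
  · exact (csInf_le hbdd (mem_image_of_mem _ hx₀)).trans (div_le_one_of_le₀ (hgf _ hx₀) (hf _ hx₀))
  · rcases (hf x hx).eq_or_lt with h0 | h0
    · have := le_antisymm ((hgf x hx).trans h0.ge) (hg x hx)
      simp [← h0, this]
    constructor
    · rw [← le_div_iff₀ h0]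
      exact csInf_le hbdd (mem_image_of_mem _ hx)
    · rw [← mul_assoc, ← div_le_iff₀ h0, mul_comm, ← div_le_iff₀ (by positivity)]
      refine le_csInf hne (forall_mem_image.2 fun y hy => ?_)
      -- By `ξ`-boundedness, `f` positive at one point is positive everywhere, so no conventional
      -- zero quotient enters the infimum here.
      have hy0 : 0 < f y := by
        have := hfb x hx y hy
        by_contra! hcon
        nlinarith
      rw [div_div, div_le_div_iff₀ (by positivity) hy0]
      have h1 := hgb x hx y hy
      have h2 := hfb y hy x hx
      have h3 := hg y hy
      calc g x * f y ≤ (ξ * g y) * (ξ * f x) := by gcongr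
        _ = _ := by ring

/-- The Poisson weights at `fA` and `fB` are not ordered. Trading `g` for multiples of `fB` and `fA`
makes both integrals exact under integration by parts, after which only antitonicity of `poissonCDF`
is needed. -/
theorem visibilityRateDeriv_le {ξ : ℝ} (ht : 0 < t) (hξ : 1 ≤ ξ)
    (hgi : IntervalIntegrable g volume 0 t) (hAi : IntervalIntegrable fA volume 0 t)
    (hBi : IntervalIntegrable fB volume 0 t) (hmi : IntervalIntegrable m volume 0 t)
    (hg : ∀ x ∈ Ioo 0 t, 0 ≤ g x) (hm : ∀ x ∈ Ioo 0 t, 0 ≤ m x)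
    (hgA : ∀ x ∈ Ioo 0 t, g x ≤ fA x) (hAB : ∀ x ∈ Ioo 0 t, fA x ≤ fB x)
    (hgb : XiBounded ξ t g) (hBb : XiBounded ξ t fB) :
    visibilityRateDeriv n t g fB m ≤ ξ ^ 2 * visibilityRateDeriv n t g fA m := by
  obtain ⟨p, hp0, hp1, hp⟩ :=
    exists_ratio_bounds ht hξ hg (fun x hx => (hgA x hx).trans (hAB x hx)) hgb hBb
  have h0 : (0 : ℝ) ∈ Icc 0 t := ⟨le_rfl, ht.le⟩
  have hA : ∀ x ∈ Ioo 0 t, 0 ≤ fA x := fun x hx => (hg x hx).trans (hgA x hx)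
  have hB : ∀ x ∈ Ioo 0 t, 0 ≤ fB x := fun x hx => (hA x hx).trans (hAB x hx)
  have hw : ∀ {f : ℝ → ℝ}, (∀ x ∈ Ioo 0 t, 0 ≤ f x) → ∀ x ∈ Ioo 0 t,
      0 ≤ (Real.exp (-∫ y in x..t, f y) * (∫ y in x..t, f y) ^ n / n.factorial) *
        ∫ y in x..t, m y := by
    intro f hf x hx
    have h1 := tail_nonneg hf (Ioo_subset_Icc_self hx)
    have h2 := tail_nonneg hm (Ioo_subset_Icc_self hx)
    positivity
  have hi : ∀ {f k : ℝ → ℝ}, IntervalIntegrable f volume 0 t → IntervalIntegrable k volume 0 t →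
      IntervalIntegrable (fun x => k x * ((Real.exp (-∫ y in x..t, f y) *
        (∫ y in x..t, f y) ^ n / n.factorial) * ∫ y in x..t, m y)) volume 0 t :=
    fun hf hk => hk.mul_continuousOn (continuousOn_poissonWeight_tail hf hmi)
  have hup := intervalIntegral.integral_mono_on_of_le_Ioo ht.le (hi hBi hgi)
    ((hi hBi hBi).const_mul (ξ ^ 2 * p)) fun x hx => by
      refine (mul_le_mul_of_nonneg_right (hp x hx).2 (hw hB x hx)).trans_eq ?_
      ring
  -- Here `p fA ≤ p fB ≤ g`, so the ratio bound for `fB` also serves at `fA`.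
  have hlow := intervalIntegral.integral_mono_on_of_le_Ioo ht.le ((hi hAi hAi).const_mul p)
    (hi hAi hgi) fun x hx => by
      rw [← mul_assoc]
      refine mul_le_mul_of_nonneg_right ?_ (hw hA x hx)
      exact (mul_le_mul_of_nonneg_left (hAB x hx) hp0).trans (hp x hx).1
  have hmid := intervalIntegral.integral_mono_on_of_le_Ioo ht.le
    (hmi.mul_continuousOn (continuousOn_poissonCDF_tail (n := n) hBi))
    (hmi.mul_continuousOn (continuousOn_poissonCDF_tail (n := n) hAi)) fun x hx =>
      mul_le_mul_of_nonneg_left (antitoneOn_poissonCDF n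
        (tail_nonneg hA (Ioo_subset_Icc_self hx)) (tail_nonneg hB (Ioo_subset_Icc_self hx))
        (tail_mono hAi hBi hAB (Ioo_subset_Icc_self hx))) (hm x hx)
  have hQ : poissonCDF n (∫ x in 0..t, fB x) ≤ poissonCDF n (∫ x in 0..t, fA x) :=
    antitoneOn_poissonCDF n (tail_nonneg hA h0) (tail_nonneg hB h0) (tail_mono hAi hBi hAB h0)
  have hQB := poissonCDF_nonneg n (tail_nonneg hB h0)
  have hm0 := tail_nonneg hm h0
  have hpA := integral_mul_deriv_poissonCDF_tail n hAi hmi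
  have hpB := integral_mul_deriv_poissonCDF_tail n hBi hmi
  simp only [mul_assoc (fA _), mul_assoc (fB _)] at hpA hpB
  rw [intervalIntegral.integral_const_mul, hpB] at hup
  rw [intervalIntegral.integral_const_mul, hpA] at hlow
  unfold visibilityRateDeriv
  have hξ2 : 1 ≤ ξ ^ 2 := one_le_pow₀ hξ
  set M := ∫ x in 0..t, m x
  set IB := ∫ x in 0..t, m x * poissonCDF n (∫ y in x..t, fB y)
  set IA := ∫ x in 0..t, m x * poissonCDF n (∫ y in x..t, fA y)
  set QB := poissonCDF n (∫ x in 0..t, fB x)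
  set QA := poissonCDF n (∫ x in 0..t, fA x)
  have h1 : M * QB ≤ ξ ^ 2 * (M * QB) := le_mul_of_one_le_left (by positivity) hξ2
  have h2 : p * IB ≤ p * IA := by gcongr
  have h3 : (1 - p) * (M * QB) ≤ (1 - p) * (M * QA) := by
    have : 0 ≤ 1 - p := by linarith
    gcongr
  -- Since `ξ² ≥ 1`, the bound at `fB` becomes `ξ²` times the convex combination of `M * QB` and
  -- `IB` with weights `1 - p` and `p`. Both quantities grow on passing to `fA`, where the lower
  -- bound has the same shape.
  calc _ ≤ M * QB + ξ ^ 2 * p * (IB - M * QB) := by gcongr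
    _ ≤ ξ ^ 2 * ((1 - p) * (M * QB) + p * IB) := by linarith
    _ ≤ ξ ^ 2 * ((1 - p) * (M * QA) + p * IA) := by gcongr
    _ = ξ ^ 2 * (M * QA + p * (IA - M * QA)) := by ring
    _ ≤ _ := by gcongr

/-- Differentiating under the integral gives `∫ m Q - ∫ (f + s m - g) w M`, with `M` the tail of
`m`. Integrating the `(f + s m) w M` part by parts cancels the first integral and leaves
`visibilityRateDeriv`. -/
theorem hasDerivAt_visibilityRate (hgi : IntervalIntegrable g volume 0 t)
    (hfi : IntervalIntegrable f volume 0 t) (hmi : IntervalIntegrable m volume 0 t) (s : ℝ) :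
    HasDerivAt (fun s => visibilityRate n t g (fun x => f x + s * m x))
      (visibilityRateDeriv n t g (fun x => f x + s * m x) m) s := by
  set w : ℝ → ℝ := fun l => Real.exp (-l) * l ^ n / n.factorial with hw
  have hwc : Continuous w := by fun_prop
  have hFc := continuousOn_tail hfi
  have hMc := continuousOn_tail hmi
  have hlin : ∀ s, ∀ x ∈ uIcc 0 t, ∫ y in x..t, (f y + s * m y) =
      (∫ y in x..t, f y) + s * ∫ y in x..t, m y := by
    intro s x hx
    have hsub : uIcc x t ⊆ uIcc 0 t := uIcc_subset_uIcc_right hx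
    rw [intervalIntegral.integral_add (hfi.mono_set hsub) ((hmi.mono_set hsub).const_mul s),
      intervalIntegral.integral_const_mul]
  have hV : ∀ s, visibilityRate n t g (fun x => f x + s * m x) =
      ∫ x in 0..t, (f x + s * m x - g x) *
        poissonCDF n ((∫ y in x..t, f y) + s * ∫ y in x..t, m y) := by
    intro s
    refine intervalIntegral.integral_congr fun x hx => ?_
    simp only [hlin s x hx]
  have hsi : ∀ s, IntervalIntegrable (fun x => f x + s * m x) volume 0 t :=
    fun s => hfi.add (hmi.const_mul s)
  have hQc : ∀ s, ContinuousOn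
      (fun x => poissonCDF n ((∫ y in x..t, f y) + s * ∫ y in x..t, m y)) (uIcc 0 t) :=
    fun s => (continuous_poissonCDF n).comp_continuousOn (hFc.add (hMc.const_smul s))
  have hwMc : ∀ s, ContinuousOn (fun x => w ((∫ y in x..t, f y) + s * ∫ y in x..t, m y) *
      ∫ y in x..t, m y) (uIcc 0 t) :=
    fun s => (hwc.comp_continuousOn (hFc.add (hMc.const_smul s))).mul hMc
  have hD : visibilityRateDeriv n t g (fun x => f x + s * m x) m =
      ∫ x in 0..t, (m x * poissonCDF n ((∫ y in x..t, f y) + s * ∫ y in x..t, m y) -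
        (f x + s * m x - g x) * (w ((∫ y in x..t, f y) + s * ∫ y in x..t, m y) *
          ∫ y in x..t, m y)) := by
    have h := integral_mul_deriv_poissonCDF_tail n (hsi s) hmi
    have e1 : ∫ x in 0..t, (f x + s * m x) * (Real.exp (-∫ y in x..t, (f y + s * m y)) *
        (∫ y in x..t, (f y + s * m y)) ^ n / n.factorial) * (∫ y in x..t, m y) =
        ∫ x in 0..t, (f x + s * m x) * (w ((∫ y in x..t, f y) + s * ∫ y in x..t, m y) *
          ∫ y in x..t, m y) := by
      refine intervalIntegral.integral_congr fun x hx => ?_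
      simp only [hlin s x hx, hw, mul_assoc]
    have e2 : ∫ x in 0..t, m x * poissonCDF n (∫ y in x..t, (f y + s * m y)) =
        ∫ x in 0..t, m x * poissonCDF n ((∫ y in x..t, f y) + s * ∫ y in x..t, m y) := by
      refine intervalIntegral.integral_congr fun x hx => ?_
      simp only [hlin s x hx]
    have e3 : ∫ x in 0..t, g x * ((Real.exp (-∫ y in x..t, (f y + s * m y)) *
        (∫ y in x..t, (f y + s * m y)) ^ n / n.factorial) * (∫ y in x..t, m y)) =
        ∫ x in 0..t, g x * (w ((∫ y in x..t, f y) + s * ∫ y in x..t, m y) *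
          ∫ y in x..t, m y) := by
      refine intervalIntegral.integral_congr fun x hx => ?_
      simp only [hlin s x hx, hw]
    rw [e1, e2] at h
    simp only [sub_mul _ (g _)]
    rw [intervalIntegral.integral_sub (hmi.mul_continuousOn (hQc s))
      (((hsi s).mul_continuousOn (hwMc s)).sub (hgi.mul_continuousOn (hwMc s))),
      intervalIntegral.integral_sub ((hsi s).mul_continuousOn (hwMc s))
        (hgi.mul_continuousOn (hwMc s)), h, visibilityRateDeriv, e3]
    ring
  simp only [hV]
  rw [hD]
  -- The tail-dependent factors are continuous on a compact rectangle in `(s, x)`; their bounds `C`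
  -- and `D` give an integrable dominating function.
  obtain ⟨C, hC⟩ := (isCompact_Icc (a := s - 1) (b := s + 1)).prod (isCompact_uIcc (a := 0) (b := t))
    |>.exists_bound_of_continuousOn
      (f := fun z : ℝ × ℝ => poissonCDF n ((∫ y in z.2..t, f y) + z.1 * ∫ y in z.2..t, m y))
      ((continuous_poissonCDF n).comp_continuousOn
        (((hFc.comp continuousOn_snd fun z hz => hz.2)).add
          (continuousOn_fst.mul (hMc.comp continuousOn_snd fun z hz => hz.2))))
  obtain ⟨D, hD'⟩ := (isCompact_Icc (a := s - 1) (b := s + 1)).prod (isCompact_uIcc (a := 0) (b := t))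
    |>.exists_bound_of_continuousOn
      (f := fun z : ℝ × ℝ => w ((∫ y in z.2..t, f y) + z.1 * ∫ y in z.2..t, m y) *
        ∫ y in z.2..t, m y)
      ((hwc.comp_continuousOn
        (((hFc.comp continuousOn_snd fun z hz => hz.2)).add
          (continuousOn_fst.mul (hMc.comp continuousOn_snd fun z hz => hz.2)))).mul
        (hMc.comp continuousOn_snd fun z hz => hz.2))
  refine (intervalIntegral.hasDerivAt_integral_of_dominated_loc_of_deriv_le
    (F := fun s x => (f x + s * m x - g x) *
        poissonCDF n ((∫ y in x..t, f y) + s * ∫ y in x..t, m y))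
    (F' := fun s x => m x * poissonCDF n ((∫ y in x..t, f y) + s * ∫ y in x..t, m y) -
        (f x + s * m x - g x) * (w ((∫ y in x..t, f y) + s * ∫ y in x..t, m y) *
          ∫ y in x..t, m y))
    (bound := fun x => ‖m x‖ * C + (‖f x‖ + (|s| + 1) * ‖m x‖ + ‖g x‖) * D)
    (Icc_mem_nhds (sub_one_lt s) (lt_add_one s)) ?_ ?_ ?_ ?_ ?_ ?_).2
  · refine Filter.Eventually.of_forall fun s => ?_
    exact (intervalIntegrable_iff.1 (((hsi s).sub hgi).mul_continuousOn (hQc s))).aestronglyMeasurable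
  · exact ((hsi s).sub hgi).mul_continuousOn (hQc s)
  · exact (intervalIntegrable_iff.1 ((hmi.mul_continuousOn (hQc s)).sub
      (((hsi s).sub hgi).mul_continuousOn (hwMc s)))).aestronglyMeasurable
  · refine Filter.Eventually.of_forall fun x hx r hr => ?_
    have h1 := hC (r, x) ⟨hr, uIoc_subset_uIcc hx⟩
    have h2 := hD' (r, x) ⟨hr, uIoc_subset_uIcc hx⟩
    have h3 : ‖f x + r * m x - g x‖ ≤ ‖f x‖ + (|s| + 1) * ‖m x‖ + ‖g x‖ := by
      have hr' : ‖r‖ ≤ |s| + 1 := by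
        rw [Real.norm_eq_abs, abs_le]
        have := neg_abs_le s
        have := le_abs_self s
        constructor <;> linarith [hr.1, hr.2]
      calc _ ≤ ‖f x‖ + ‖r * m x‖ + ‖g x‖ :=
            (norm_sub_le _ _).trans (by gcongr; exact norm_add_le _ _)
        _ ≤ _ := by rw [norm_mul]; gcongr
    refine (norm_sub_le _ _).trans ?_
    rw [norm_mul, norm_mul (f x + r * m x - g x)]
    gcongr
  · exact (hmi.norm.mul_const C).add
      (((hfi.norm.add (hmi.norm.const_mul _)).add hgi.norm).mul_const D)
  · refine Filter.Eventually.of_forall fun x _ r _ => ?_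
    have h1 : HasDerivAt (fun s => f x + s * m x - g x) (m x) r := by
      simpa using (((hasDerivAt_id r).mul_const (m x)).const_add (f x)).sub_const (g x)
    have h2 : HasDerivAt (fun s => (∫ y in x..t, f y) + s * ∫ y in x..t, m y)
        (∫ y in x..t, m y) r := by
      simpa using ((hasDerivAt_id r).mul_const (∫ y in x..t, m y)).const_add (∫ y in x..t, f y)
    convert! h1.mul ((hasDerivAt_poissonCDF n _).comp r h2) using 1
    simp only [hw, Function.comp]
    ring

/-- Adding intensity `m` to the feed increases the visibility. -/
theorem visibilityRate_le_add (ht : 0 < t) (hgi : IntervalIntegrable g volume 0 t)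
    (hfi : IntervalIntegrable f volume 0 t) (hmi : IntervalIntegrable m volume 0 t)
    (hg : ∀ x ∈ Ioo 0 t, 0 ≤ g x) (hm : ∀ x ∈ Ioo 0 t, 0 ≤ m x)
    (hf : ∀ x ∈ Ioo 0 t, 0 ≤ f x) :
    visibilityRate n t g f ≤ visibilityRate n t g (fun x => f x + m x) := by
  have hd := hasDerivAt_visibilityRate (n := n) hgi hfi hmi
  have h := monotoneOn_of_deriv_nonneg (convex_Icc (0 : ℝ) 1)
    (fun s _ => (hd s).continuousAt.continuousWithinAt)
    (fun s _ => (hd s).differentiableAt.differentiableWithinAt) (fun s hs => by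
      rw [interior_Icc] at hs
      rw [(hd s).deriv]
      exact visibilityRateDeriv_nonneg ht.le hg
        (fun x hx => add_nonneg (hf x hx) (mul_nonneg hs.1.le (hm x hx))) hm)
    (left_mem_Icc.2 zero_le_one) (right_mem_Icc.2 zero_le_one) zero_le_one
  simpa using h

/-- The gain of visibility from additional intensity `m` decreases, up to a factor `ξ ^ 2`, when
the intensity of the feed grows from `fA` to `fB`. -/
theorem visibilityRate_gain_le {ξ : ℝ} (ht : 0 < t) (hξ : 1 ≤ ξ)
    (hgi : IntervalIntegrable g volume 0 t) (hAi : IntervalIntegrable fA volume 0 t)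
    (hBi : IntervalIntegrable fB volume 0 t) (hmi : IntervalIntegrable m volume 0 t)
    (hg : ∀ x ∈ Ioo 0 t, 0 ≤ g x) (hm : ∀ x ∈ Ioo 0 t, 0 ≤ m x)
    (hgA : ∀ x ∈ Ioo 0 t, g x ≤ fA x) (hAB : ∀ x ∈ Ioo 0 t, fA x ≤ fB x)
    (hgb : XiBounded ξ t g) (hBb : XiBounded ξ t fB)
    (hBmb : XiBounded ξ t (fun x => fB x + m x)) :
    visibilityRate n t g (fun x => fB x + m x) - visibilityRate n t g fB ≤
      ξ ^ 2 * (visibilityRate n t g (fun x => fA x + m x) - visibilityRate n t g fA) := by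
  have hd := fun s => ((hasDerivAt_visibilityRate (n := n) hgi hAi hmi s).const_mul (ξ ^ 2)).sub
    (hasDerivAt_visibilityRate (n := n) hgi hBi hmi s)
  have h := monotoneOn_of_deriv_nonneg (convex_Icc (0 : ℝ) 1)
    (fun s _ => (hd s).continuousAt.continuousWithinAt)
    (fun s _ => (hd s).differentiableAt.differentiableWithinAt) (fun s hs => by
      rw [interior_Icc] at hs
      rw [(hd s).deriv, sub_nonneg]
      refine visibilityRateDeriv_le ht hξ hgi (hAi.add (hmi.const_mul s))
        (hBi.add (hmi.const_mul s)) hmi hg hm (fun x hx => ?_) (fun x hx => ?_) hgb ?_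
      · exact (hgA x hx).trans (le_add_of_nonneg_right (mul_nonneg hs.1.le (hm x hx)))
      · exact add_le_add_left (hAB x hx) _
      -- `fB + s m` is a convex combination of `fB` and `fB + m`, and such combinations preserve
      -- `ξ`-boundedness.
      · intro x hx y hy
        have h1 := hBb x hx y hy
        have h2 := hBmb x hx y hy
        have h3 := hs.1
        have h4 := hs.2
        nlinarith)
    (left_mem_Icc.2 zero_le_one) (right_mem_Icc.2 zero_le_one) zero_le_one
  simp only [Pi.sub_apply, zero_mul, add_zero, one_mul] at h
  linarith

end

/-! ### Discretization: Riemann–Stieltjes sums and exact counting on fine partitions. -/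

open Filter Topology in
/-- Riemann–Stieltjes sums with respect to the measure with density `lam`. -/
theorem tendsto_sum_integral_mul {t : ℝ} (ht : 0 ≤ t) {lam φ : ℝ → ℝ}
    (hlam : IntervalIntegrable lam volume 0 t) (hlam0 : ∀ x ∈ Icc 0 t, 0 ≤ lam x)
    (hφ : ContinuousOn φ (Icc 0 t)) :
    Tendsto (fun m : ℕ => ∑ k ∈ Finset.range (m + 1),
      (∫ x in (t * (k / (m + 1) : ℝ))..(t * ((k + 1 : ℕ) / (m + 1) : ℝ)), lam x) *
        φ (t * ((k + 1 : ℕ) / (m + 1) : ℝ))) atTop (𝓝 (∫ x in 0..t, lam x * φ x)) := by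
  have hI : 0 ≤ ∫ x in 0..t, lam x := intervalIntegral.integral_nonneg ht hlam0
  rw [Metric.tendsto_atTop]
  intro ε hε
  -- The `+ 1` keeps the tolerance well defined when `lam` has zero mass.
  obtain ⟨δ, hδ, hδφ⟩ := Metric.uniformContinuousOn_iff.1
    (isCompact_Icc.uniformContinuousOn_of_continuous hφ) (ε / ((∫ x in 0..t, lam x) + 1))
    (by positivity)
  obtain ⟨m₀, hm₀⟩ := exists_nat_gt (t / δ)
  refine ⟨m₀, fun m hm => ?_⟩
  set a : ℕ → ℝ := fun k => t * (k / (m + 1) : ℝ) with ha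
  have hm1 : (0 : ℝ) < m + 1 := by positivity
  have hmesh : ∀ k, a (k + 1) - a k < δ := by
    intro k
    have : a (k + 1) - a k = t / (m + 1) := by simp only [ha]; push_cast; field_simp; ring
    rw [this, div_lt_comm₀ hm1 hδ]
    have : (m₀ : ℝ) ≤ m := by exact_mod_cast hm
    linarith
  have hmono : Monotone a := fun k l hkl => by
    simp only [ha]
    gcongr
  have ha0 : a 0 = 0 := by simp [ha]
  have ham : a (m + 1) = t := by simp only [ha]; push_cast; field_simp
  have hmem : ∀ k ≤ m + 1, a k ∈ Icc 0 t := fun k hk =>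
    ⟨ha0 ▸ hmono (Nat.zero_le k), ham ▸ hmono hk⟩
  have hsub : ∀ k < m + 1, uIcc (a k) (a (k + 1)) ⊆ uIcc 0 t := fun k hk =>
    uIcc_subset_uIcc (by rw [uIcc_of_le ht]; exact hmem k hk.le)
      (by rw [uIcc_of_le ht]; exact hmem (k + 1) hk)
  have hprod : IntervalIntegrable (fun x => lam x * φ x) volume 0 t :=
    hlam.mul_continuousOn (by rwa [uIcc_of_le ht])
  have e1 : ∫ x in 0..t, lam x * φ x =
      ∑ k ∈ Finset.range (m + 1), ∫ x in (a k)..(a (k + 1)), lam x * φ x := by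
    rw [intervalIntegral.sum_integral_adjacent_intervals fun k hk => hprod.mono_set (hsub k hk),
      ha0, ham]
  have e2 : ∫ x in 0..t, lam x = ∑ k ∈ Finset.range (m + 1), ∫ x in (a k)..(a (k + 1)), lam x := by
    rw [intervalIntegral.sum_integral_adjacent_intervals fun k hk => hlam.mono_set (hsub k hk),
      ha0, ham]
  rw [e1, Real.dist_eq, ← Finset.sum_sub_distrib]
  calc _ ≤ ∑ k ∈ Finset.range (m + 1), (ε / ((∫ x in 0..t, lam x) + 1)) *
        ∫ x in (a k)..(a (k + 1)), lam x := by
        refine (Finset.abs_sum_le_sum_abs _ _).trans (Finset.sum_le_sum fun k hk => ?_)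
        have hk := Finset.mem_range.1 hk
        rw [mul_comm, ← intervalIntegral.integral_const_mul, ← intervalIntegral.integral_sub
          ((hlam.mono_set (hsub k hk)).const_mul _) (hprod.mono_set (hsub k hk)),
          ← intervalIntegral.integral_const_mul]
        have hle : a k ≤ a (k + 1) := hmono (Nat.le_succ k)
        rw [← Real.norm_eq_abs]
        refine intervalIntegral.norm_integral_le_of_norm_le hle ?_
          ((hlam.mono_set (hsub k hk)).const_mul _)
        refine Eventually.of_forall fun x hx => ?_
        have hx' : x ∈ Icc 0 t := ⟨(hmem k hk.le).1.trans hx.1.le, hx.2.trans (hmem _ hk).2⟩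
        have hd := hδφ (a (k + 1)) (hmem _ hk) x hx' (by
          rw [Real.dist_eq, abs_of_nonneg (sub_nonneg.2 hx.2)]
          linarith [hmesh k, hx.1])
        rw [mul_comm (φ _), ← mul_sub, norm_mul, Real.norm_of_nonneg (hlam0 x hx'), mul_comm]
        exact mul_le_mul_of_nonneg_right hd.le (hlam0 x hx')
    _ = ε / ((∫ x in 0..t, lam x) + 1) * ∫ x in 0..t, lam x := by rw [← Finset.mul_sum, ← e2]
    _ < ε := by
      rw [div_mul_eq_mul_div, div_lt_iff₀ (by positivity)]
      nlinarith

section PostCount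

variable {N : Set ℝ} {t : ℝ}

theorem postCount_add (hN : (N ∩ Ioc 0 t).Finite) {a b c : ℝ} (ha : 0 ≤ a) (hab : a ≤ b)
    (hbc : b ≤ c) (hc : c ≤ t) : postCount N a b + postCount N b c = postCount N a c := by
  have hsub : ∀ {u v}, 0 ≤ u → v ≤ t → (N ∩ Ioc u v).Finite := fun hu hv =>
    hN.subset (inter_subset_inter_right _ (Ioc_subset_Ioc hu hv))
  unfold postCount
  rw [← ncard_union_eq _ (hsub ha (hbc.trans hc)) (hsub (ha.trans hab) hc), ← inter_union_distrib_left,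
    Ioc_union_Ioc_eq_Ioc hab hbc]
  exact (Ioc_disjoint_Ioc_of_le le_rfl).mono inter_subset_right inter_subset_right

theorem sum_postCount (hN : (N ∩ Ioc 0 t).Finite) {a : ℕ → ℝ} (ha : Monotone a) (ha0 : a 0 = 0)
    (m : ℕ) (ham : a m ≤ t) :
    ∑ k ∈ Finset.range m, postCount N (a k) (a (k + 1)) = postCount N 0 (a m) := by
  induction m with
  | zero => simp [ha0, postCount]
  | succ m ih =>
    have h := ha (Nat.le_succ m)
    rw [Finset.sum_range_succ, ih (h.trans ham)]
    exact postCount_add hN le_rfl (ha0 ▸ ha (Nat.zero_le m)) h ham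

end PostCount

open Filter in
/-- The number of points of `N i` that are followed by fewer than `K` points of the sets `N k`,
`k ∈ s`, is computed exactly by all sufficiently fine partitions. -/
theorem eventually_ncard_eq_sum {ι : Type*} (N : ι → Set ℝ) (s : Finset ι) {i : ι} (hi : i ∈ s)
    (K : ℕ) {t : ℝ} (ht : 0 < t) (hN : ∀ k ∈ s, (N k ∩ Ioc 0 t).Finite) :
    ∀ᶠ m : ℕ in atTop,
      {τ : ℝ | τ ∈ N i ∧ τ ∈ Ioc 0 t ∧ ∑ k ∈ s, postCount (N k) τ t < K}.ncard =
        ∑ l ∈ Finset.range (m + 1),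
          postCount (N i) (t * (l / (m + 1) : ℝ)) (t * ((l + 1 : ℕ) / (m + 1) : ℝ)) *
            (if ∑ k ∈ s, postCount (N k) (t * ((l + 1 : ℕ) / (m + 1) : ℝ)) t < K then 1 else 0) := by
  classical
  set Z : Set ℝ := ⋃ k ∈ s, N k ∩ Ioc 0 t with hZ
  have hZfin : Z.Finite := s.finite_toSet.biUnion hN
  -- `δ` is the least gap between distinct points of all the sources. With mesh below `δ`, no point
  -- follows `τ` inside its own cell, so counting after `τ` equals counting after the right
  -- endpoint.
  obtain ⟨δ, hδ, hgap⟩ : ∃ δ > 0, ∀ x ∈ Z, ∀ y ∈ Z, x < y → δ ≤ y - x := by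
    have hfin : ((fun z : ℝ × ℝ => z.2 - z.1) '' ((Z ×ˢ Z) ∩ {z | z.1 < z.2})).Finite :=
      ((hZfin.prod hZfin).inter_of_left _).image _
    rcases (((fun z : ℝ × ℝ => z.2 - z.1) '' ((Z ×ˢ Z) ∩ {z | z.1 < z.2}))).eq_empty_or_nonempty
      with he | hne
    · refine ⟨1, one_pos, fun x hx y hy hxy => ?_⟩
      have : y - x ∈ ((fun z : ℝ × ℝ => z.2 - z.1) '' ((Z ×ˢ Z) ∩ {z | z.1 < z.2})) :=
        ⟨(x, y), ⟨⟨hx, hy⟩, hxy⟩, rfl⟩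
      simp [he] at this
    · obtain ⟨δ, ⟨z, hz, rfl⟩, hmin⟩ := exists_min_image _ id hfin hne
      exact ⟨_, sub_pos.2 hz.2, fun x hx y hy hxy => hmin _ ⟨(x, y), ⟨⟨hx, hy⟩, hxy⟩, rfl⟩⟩
  obtain ⟨m₀, hm₀⟩ := exists_nat_gt (t / δ)
  filter_upwards [eventually_ge_atTop m₀] with m hm
  set a : ℕ → ℝ := fun k => t * (k / (m + 1) : ℝ) with ha
  have hm1 : (0 : ℝ) < m + 1 := by positivity
  have hmesh : ∀ k, a (k + 1) - a k < δ := by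
    intro k
    have : a (k + 1) - a k = t / (m + 1) := by simp only [ha]; push_cast; field_simp; ring
    rw [this, div_lt_comm₀ hm1 hδ]
    have : (m₀ : ℝ) ≤ m := by exact_mod_cast hm
    linarith
  have hmono : Monotone a := fun k l hkl => by
    simp only [ha]
    gcongr
  have ha0 : a 0 = 0 := by simp [ha]
  have ham : a (m + 1) = t := by simp only [ha]; push_cast; field_simp
  set A : Set ℝ := {τ : ℝ | τ ∈ N i ∧ τ ∈ Ioc 0 t ∧ ∑ k ∈ s, postCount (N k) τ t < K} with hA
  have hAt : A ∩ Ioc 0 t = A := inter_eq_left.2 fun x hx => hx.2.1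
  have hAfin : (A ∩ Ioc 0 t).Finite := (hN i hi).subset fun x hx => ⟨hx.1.1, hx.2⟩
  have hsum := sum_postCount hAfin hmono ha0 (m + 1) ham.le
  rw [ham, postCount, hAt] at hsum
  rw [← hsum]
  refine Finset.sum_congr rfl fun l hl => ?_
  have hl' : l + 1 ≤ m + 1 := Finset.mem_range.1 hl
  have hl0 : 0 ≤ a l := ha0 ▸ hmono (Nat.zero_le l)
  have hlt : a (l + 1) ≤ t := ham ▸ hmono hl'
  have key : ∀ τ ∈ N i ∩ Ioc (a l) (a (l + 1)),
      ∑ k ∈ s, postCount (N k) τ t = ∑ k ∈ s, postCount (N k) (a (l + 1)) t := by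
    intro τ hτ
    refine Finset.sum_congr rfl fun k hk => ?_
    have hτ0 : 0 < τ := hl0.trans_lt hτ.2.1
    rw [← postCount_add (hN k hk) hτ0.le hτ.2.2 hlt le_rfl, Nat.add_eq_right, postCount]
    convert ncard_empty ℝ
    refine eq_empty_of_forall_notMem fun y hy => ?_
    have h1 := hgap τ (mem_biUnion hi ⟨hτ.1, hτ0, hτ.2.2.trans hlt⟩) y
      (mem_biUnion hk ⟨hy.1, hτ0.trans hy.2.1, hy.2.2.trans hlt⟩) hy.2.1
    linarith [hmesh l, hτ.2.1, hy.2.2]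
  show postCount A (a l) (a (l + 1)) = postCount (N i) (a l) (a (l + 1)) * _
  split_ifs with h
  · rw [mul_one, postCount, postCount]
    congr 1
    ext τ
    refine ⟨fun hτ => ⟨hτ.1.1, hτ.2⟩, fun hτ => ⟨⟨hτ.1, ⟨hl0.trans_lt hτ.2.1, hτ.2.2.trans hlt⟩, ?_⟩,
      hτ.2⟩⟩
    rw [key τ hτ]
    exact h
  · rw [mul_zero, postCount]
    convert ncard_empty ℝ
    refine eq_empty_of_forall_notMem fun τ hτ => h ?_
    have := hτ.1.2.2
    rwa [key τ ⟨hτ.1.1, hτ.2⟩] at this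

/-! ### Poisson laws and an independence lemma. -/

theorem hasSum_id_poissonMeasure (r : ℝ≥0) :
    HasSum (fun n : ℕ => Real.exp (-r) * r ^ n / n.factorial * n) r := by
  rw [← hasSum_nat_add_iff' 1]
  have h := (hasSum_one_poissonMeasure r).mul_left (r : ℝ)
  simp only [mul_one] at h
  simp only [Finset.range_one, Finset.sum_singleton, Nat.cast_zero, mul_zero, sub_zero]
  convert! h using 2 with n
  rw [Nat.factorial_succ]
  have : (n.factorial : ℝ) ≠ 0 := by positivity
  push_cast
  field_simp
  ring

theorem integrable_cast_poissonMeasure (r : ℝ≥0) :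
    Integrable (fun n : ℕ => (n : ℝ)) (poissonMeasure r) := by
  rw [integrable_poissonMeasure_iff]
  simpa using (hasSum_id_poissonMeasure r).summable

theorem integral_cast_poissonMeasure (r : ℝ≥0) :
    ∫ n : ℕ, (n : ℝ) ∂(poissonMeasure r) = r := by
  rw [integral_poissonMeasure]
  simpa using (hasSum_id_poissonMeasure r).tsum_eq

theorem poissonMeasure_real_lt (r : ℝ≥0) (n : ℕ) :
    (poissonMeasure r).real {k | k < n + 1} = poissonCDF n r := by
  have h : {k : ℕ | k < n + 1} = (Finset.range (n + 1) : Set ℕ) := by ext; simp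
  rw [h, ← sum_measureReal_singleton]
  simp only [poissonMeasure_real_singleton, poissonCDF]

/-- If `U` and `Y` are independent and `(U, Y)` is independent of `R`, then `U` is independent of
`(Y, R)`. -/
theorem ProbabilityTheory.IndepFun.prodMk_right {Ω α β δ : Type*} [MeasurableSpace Ω]
    [MeasurableSpace α] [MeasurableSpace β] [MeasurableSpace δ] {P : Measure Ω}
    [IsProbabilityMeasure P] {U : Ω → α} {Y : Ω → β} {R : Ω → δ} (hU : Measurable U)
    (hY : Measurable Y) (hR : Measurable R) (hUY : IndepFun U Y P)
    (hUYR : IndepFun (fun ω => (U ω, Y ω)) R P) : IndepFun U (fun ω => (Y ω, R ω)) P := by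
  have := Measure.isProbabilityMeasure_map (μ := P) hU.aemeasurable
  have := Measure.isProbabilityMeasure_map (μ := P) hY.aemeasurable
  have := Measure.isProbabilityMeasure_map (μ := P) hR.aemeasurable
  have hYR : IndepFun Y R P := hUYR.comp measurable_snd measurable_id
  rw [indepFun_iff_map_prod_eq_prod_map_map (by fun_prop) (by fun_prop)] at hUYR hUY hYR ⊢
  rw [hYR, ← Measure.prodAssoc_prod, ← hUY, ← hUYR,
    Measure.map_map MeasurableEquiv.prodAssoc.measurable (by fun_prop)]
  rfl

/-! ### Counts of a single Poisson process. -/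

section SinglePoisson

variable {Ω : Type*} [MeasurableSpace Ω] {P : Measure Ω} {N : Ω → Set ℝ} {lam : ℝ → ℝ}

namespace IsPoissonProcess

theorem postCount_eq (hN : IsPoissonProcess P N lam) {a b : ℝ} (ha : 0 ≤ a) (hab : a ≤ b) (ω : Ω) :
    postCount (N ω) a b =
      countingProcess N b.toNNReal ω - countingProcess N a.toNNReal ω := by
  simp only [countingProcess, Real.coe_toNNReal _ ha, Real.coe_toNNReal _ (ha.trans hab)]
  rw [← postCount_add (hN.locallyFinite ω b) le_rfl ha hab le_rfl]
  omega

theorem measurable_postCount (hN : IsPoissonProcess P N lam) {a b : ℝ} (ha : 0 ≤ a)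
    (hab : a ≤ b) : Measurable (fun ω => postCount (N ω) a b) := by
  simp only [hN.postCount_eq ha hab]
  exact (hN.measurable_count _).sub (hN.measurable_count _)

theorem intervalIntegrable (hN : IsPoissonProcess P N lam) {a b : ℝ} (ha : 0 ≤ a)
    (hb : 0 ≤ b) : IntervalIntegrable lam volume a b :=
  (hN.intensity_integrable a ha).symm.trans (hN.intensity_integrable b hb)

theorem integral_nonneg (hN : IsPoissonProcess P N lam) {a b : ℝ} (ha : 0 ≤ a) (hab : a ≤ b) :
    0 ≤ ∫ x in a..b, lam x :=
  intervalIntegral.integral_nonneg hab fun x hx => hN.intensity_nonneg x (ha.trans hx.1)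

theorem integrable_postCount (hN : IsPoissonProcess P N lam) {a b : ℝ} (ha : 0 ≤ a)
    (hab : a ≤ b) : Integrable (fun ω => (postCount (N ω) a b : ℝ)) P := by
  have h := hN.law_count a b ha hab
  have h2 := integrable_cast_poissonMeasure (∫ x in a..b, lam x).toNNReal
  rw [← h.map_eq] at h2
  exact h2.comp_aemeasurable h.aemeasurable

theorem integral_postCount (hN : IsPoissonProcess P N lam) {a b : ℝ} (ha : 0 ≤ a)
    (hab : a ≤ b) : ∫ ω, (postCount (N ω) a b : ℝ) ∂P = ∫ x in a..b, lam x := by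
  have h := hN.law_count a b ha hab
  have h2 := integral_cast_poissonMeasure (∫ x in a..b, lam x).toNNReal
  rw [← h.map_eq, integral_map h.aemeasurable .of_discrete,
    Real.coe_toNNReal _ (hN.integral_nonneg ha hab)] at h2
  exact h2

theorem indepFun_postCount (hN : IsPoissonProcess P N lam) {a b t : ℝ} (ha : 0 ≤ a)
    (hab : a ≤ b) (hbt : b ≤ t) :
    IndepFun (fun ω => postCount (N ω) a b) (fun ω => postCount (N ω) b t) P := by
  have h := hN.indepIncrements.indepFun_sub_sub (Real.toNNReal_le_toNNReal hab)
    (Real.toNNReal_le_toNNReal hbt)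
  simp only [hN.postCount_eq ha hab, hN.postCount_eq (ha.trans hab) hbt]
  exact h

end IsPoissonProcess

end SinglePoisson

/-! ### Superposition of independent Poisson processes and expected top counts. -/

section Superposition

variable {Ω ι : Type*} [MeasurableSpace Ω] {P : Measure Ω}
  {N : ι → Ω → Set ℝ} {lam : ι → ℝ → ℝ}

theorem measurable_countingProcess_path (hN : ∀ k, IsPoissonProcess P (N k) (lam k)) (k : ι) :
    Measurable (fun ω t => countingProcess (N k) t ω) :=
  measurable_pi_lambda _ fun t => (hN k).measurable_count t

theorem iIndepFun_postCount (hN : ∀ k, IsPoissonProcess P (N k) (lam k))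
    (hind : iIndepFun (fun k ω t => countingProcess (N k) t ω) P) {a b : ℝ} (ha : 0 ≤ a)
    (hab : a ≤ b) : iIndepFun (fun k ω => postCount (N k ω) a b) P := by
  simp only [(hN _).postCount_eq ha hab]
  exact hind.comp (fun _ path => path b.toNNReal - path a.toNNReal) fun _ => by fun_prop

theorem measurable_sum_postCount (hN : ∀ k, IsPoissonProcess P (N k) (lam k)) (s : Finset ι)
    {a b : ℝ} (ha : 0 ≤ a) (hab : a ≤ b) :
    Measurable (fun ω => ∑ k ∈ s, postCount (N k ω) a b) :=
  Finset.measurable_sum s fun k _ => (hN k).measurable_postCount ha hab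

theorem intervalIntegrable_sum_intensity (hN : ∀ k, IsPoissonProcess P (N k) (lam k))
    (s : Finset ι) {a b : ℝ} (ha : 0 ≤ a) (hb : 0 ≤ b) :
    IntervalIntegrable (fun x => ∑ k ∈ s, lam k x) volume a b := by
  convert! IntervalIntegrable.sum s fun k _ => (hN k).intervalIntegrable ha hb using 1
  ext x
  simp

theorem hasLaw_sum_postCount [IsProbabilityMeasure P]
    (hN : ∀ k, IsPoissonProcess P (N k) (lam k))
    (hind : iIndepFun (fun k ω t => countingProcess (N k) t ω) P) (s : Finset ι) {a b : ℝ}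
    (ha : 0 ≤ a) (hab : a ≤ b) :
    HasLaw (fun ω => ∑ k ∈ s, postCount (N k ω) a b)
      (poissonMeasure (∫ x in a..b, ∑ k ∈ s, lam k x).toNNReal) P := by
  classical
  induction s using Finset.induction_on with
  | empty =>
    refine ⟨by simp only [Finset.sum_empty]; fun_prop, ?_⟩
    have h0 : poissonMeasure 0 = Measure.dirac 0 := by
      refine Measure.ext_of_singleton fun n => ?_
      rw [poissonMeasure_singleton]
      rcases n with _ | n <;> simp
    simp [h0]
  | insert i s hi ih =>
    have hsplit : ∫ x in a..b, ∑ k ∈ insert i s, lam k x =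
        (∫ x in a..b, ∑ k ∈ s, lam k x) + ∫ x in a..b, lam i x := by
      simp only [Finset.sum_insert hi]
      rw [intervalIntegral.integral_add ((hN i).intervalIntegrable ha (ha.trans hab))
        (intervalIntegrable_sum_intensity hN s ha (ha.trans hab)), add_comm]
    have hs0 : 0 ≤ ∫ x in a..b, ∑ k ∈ s, lam k x := intervalIntegral.integral_nonneg hab
      fun x hx => Finset.sum_nonneg fun k _ => (hN k).intensity_nonneg x (ha.trans hx.1)
    rw [hsplit, Real.toNNReal_add hs0 ((hN i).integral_nonneg ha hab)]
    have hindep := (iIndepFun_postCount hN hind ha hab).indepFun_finsetSum_of_notMem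
      (fun k => (hN k).measurable_postCount ha hab) hi
    have h := IndepFun.hasLaw_add_poissonMeasure (by convert! hindep using 1; ext; simp) ih
      ((hN i).law_count a b ha hab)
    convert! h using 1
    ext ω
    simp [Finset.sum_insert hi, add_comm]

theorem measureReal_sum_postCount_lt [IsProbabilityMeasure P]
    (hN : ∀ k, IsPoissonProcess P (N k) (lam k))
    (hind : iIndepFun (fun k ω t => countingProcess (N k) t ω) P) (s : Finset ι) (n : ℕ) {a b : ℝ}
    (ha : 0 ≤ a) (hab : a ≤ b) :
    P.real {ω | ∑ k ∈ s, postCount (N k ω) a b < n + 1} =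
      poissonCDF n (∫ x in a..b, ∑ k ∈ s, lam k x) := by
  have h := (hasLaw_sum_postCount hN hind s ha hab).measureReal_eq (p := fun k => k < n + 1)
    MeasurableSet.of_discrete
  rw [h, poissonMeasure_real_lt, Real.coe_toNNReal]
  exact intervalIntegral.integral_nonneg hab
    fun x hx => Finset.sum_nonneg fun k _ => (hN k).intensity_nonneg x (ha.trans hx.1)

/-- The posts of one source in a time interval are independent of all later posts. -/
theorem indepFun_postCount_sum [IsProbabilityMeasure P]
    (hN : ∀ k, IsPoissonProcess P (N k) (lam k))
    (hind : iIndepFun (fun k ω t => countingProcess (N k) t ω) P) (s : Finset ι) {i : ι}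
    (hi : i ∈ s) {a b t : ℝ} (ha : 0 ≤ a) (hab : a ≤ b) (hbt : b ≤ t) :
    IndepFun (fun ω => postCount (N i ω) a b) (fun ω => ∑ k ∈ s, postCount (N k ω) b t) P := by
  classical
  have hb := ha.trans hab
  -- The later posts split into those of `i`, handled by independent increments, and those of the
  -- other sources, handled by mutual independence.
  have h1 := hind.indepFun_finset {i} (s.erase i) (by simp) (measurable_countingProcess_path hN)
  have h2 : IndepFun (fun ω => (postCount (N i ω) a b, postCount (N i ω) b t))
      (fun ω => ∑ k ∈ s.erase i, postCount (N k ω) b t) P := by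
    have h := h1.comp
      (φ := fun path => (path ⟨i, Finset.mem_singleton_self i⟩ b.toNNReal -
          path ⟨i, Finset.mem_singleton_self i⟩ a.toNNReal,
        path ⟨i, Finset.mem_singleton_self i⟩ t.toNNReal -
          path ⟨i, Finset.mem_singleton_self i⟩ b.toNNReal))
      (ψ := fun path => ∑ k : s.erase i, (path k t.toNNReal - path k b.toNNReal))
      (by fun_prop) (by fun_prop)
    convert! h using 1
    · ext ω : 1
      simp only [Function.comp, (hN i).postCount_eq ha hab, (hN i).postCount_eq hb hbt]
    · ext ω
      simp only [Function.comp, (hN _).postCount_eq hb hbt]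
      exact (Finset.sum_coe_sort (s.erase i) fun k =>
        countingProcess (N k) t.toNNReal ω - countingProcess (N k) b.toNNReal ω).symm
  have h3 := IndepFun.prodMk_right ((hN i).measurable_postCount ha hab)
    ((hN i).measurable_postCount hb hbt) (measurable_sum_postCount hN _ hb hbt)
    ((hN i).indepFun_postCount ha hab hbt) h2
  have h4 := h3.comp (φ := id) (ψ := fun z : ℕ × ℕ => z.1 + z.2) measurable_id (by fun_prop)
  convert! h4 using 1
  ext ω
  simp [Finset.add_sum_erase s (fun k => postCount (N k ω) b t) hi]

open Filter Topology in
/-- The expected number of posts of source `i` during `(0, t]` that are followed by at most `n`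
posts of the sources in `s`. -/
theorem integral_ncard_followed_lt [IsProbabilityMeasure P]
    (hN : ∀ k, IsPoissonProcess P (N k) (lam k))
    (hind : iIndepFun (fun k ω t => countingProcess (N k) t ω) P) (s : Finset ι) {i : ι}
    (hi : i ∈ s) (n : ℕ) {t : ℝ} (ht : 0 < t) :
    ∫ ω, ({τ : ℝ | τ ∈ N i ω ∧ τ ∈ Ioc 0 t ∧
        ∑ k ∈ s, postCount (N k ω) τ t < n + 1}.ncard : ℝ) ∂P =
      ∫ x in 0..t, lam i x * poissonCDF n (∫ y in x..t, ∑ k ∈ s, lam k y) := by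
  have hsi : IntervalIntegrable (fun x => ∑ k ∈ s, lam k x) volume 0 t :=
    intervalIntegrable_sum_intensity hN s le_rfl ht.le
  have hlim := tendsto_sum_integral_mul ht.le ((hN i).intervalIntegrable le_rfl ht.le)
    (fun x hx => (hN i).intensity_nonneg x hx.1)
    (by simpa [uIcc_of_le ht.le] using continuousOn_poissonCDF_tail (n := n) hsi)
  set a : ℕ → ℕ → ℝ := fun m k => t * (k / (m + 1) : ℝ) with ha
  have hmono : ∀ m, Monotone (a m) := fun m k l hkl => by
    simp only [ha]
    gcongr
  have ha0 : ∀ m, a m 0 = 0 := fun m => by simp [ha]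
  have ham : ∀ m, a m (m + 1) = t := fun m => by simp only [ha]; push_cast; field_simp
  have hnn : ∀ m k, 0 ≤ a m k := fun m k => ha0 m ▸ hmono m (Nat.zero_le k)
  have hle : ∀ m, ∀ k ∈ Finset.range (m + 1), a m (k + 1) ≤ t := fun m k hk =>
    ham m ▸ hmono m (Finset.mem_range.1 hk)
  have hstep : ∀ m k, a m k ≤ a m (k + 1) := fun m k => hmono m (Nat.le_succ k)
  set D : ℝ → Ω → ℕ := fun b ω => ∑ k ∈ s, postCount (N k ω) b t with hD
  have hDm : ∀ m, ∀ k ∈ Finset.range (m + 1), Measurable (D (a m (k + 1))) := fun m k hk =>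
    measurable_sum_postCount hN s (hnn m _) (hle m k hk)
  set G : ℕ → Ω → ℝ := fun m ω => ∑ l ∈ Finset.range (m + 1),
    (postCount (N i ω) (a m l) (a m (l + 1)) : ℝ) *
      (if D (a m (l + 1)) ω < n + 1 then 1 else 0) with hG
  have hterm : ∀ m, ∀ l ∈ Finset.range (m + 1), Measurable fun ω =>
      (if D (a m (l + 1)) ω < n + 1 then (1 : ℝ) else 0) := fun m l hl =>
    (Measurable.of_discrete (f := fun k : ℕ => if k < n + 1 then (1 : ℝ) else 0)).comp (hDm m l hl)
  have hGterm_int : ∀ m, ∀ l ∈ Finset.range (m + 1), Integrable (fun ω =>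
      (postCount (N i ω) (a m l) (a m (l + 1)) : ℝ) *
        (if D (a m (l + 1)) ω < n + 1 then 1 else 0)) P := fun m l hl =>
    ((hN i).integrable_postCount (hnn m l) (hstep m l)).mul_bdd (c := 1)
      (hterm m l hl).aestronglyMeasurable
      (Eventually.of_forall fun ω => by split_ifs <;> simp)
  have hGint : ∀ m, ∫ ω, G m ω ∂P = ∑ l ∈ Finset.range (m + 1),
      (∫ x in (a m l)..(a m (l + 1)), lam i x) *
        poissonCDF n (∫ y in (a m (l + 1))..t, ∑ k ∈ s, lam k y) := by
    intro m
    rw [integral_finsetSum _ (hGterm_int m)]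
    refine Finset.sum_congr rfl fun l hl => ?_
    -- The indicator looks only past the right endpoint of the cell, so it is independent of the
    -- count inside and the expectation factors.
    have hi1 := (indepFun_postCount_sum hN hind s hi (hnn m l) (hstep m l)
      (hle m l hl)).integral_fun_comp_mul_comp (f := fun k : ℕ => (k : ℝ))
      (g := fun k : ℕ => if k < n + 1 then (1 : ℝ) else 0)
      ((hN i).measurable_postCount (hnn m l) (hstep m l)).aemeasurable
      (hDm m l hl).aemeasurable .of_discrete .of_discrete
    rw [hi1, (hN i).integral_postCount (hnn m l) (hstep m l),
      ← measureReal_sum_postCount_lt hN hind s n (hnn m _) (hle m l hl)]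
    congr 1
    rw [← integral_indicator_one (measurableSet_lt (hDm m l hl) measurable_const)]
    refine integral_congr_ae (Eventually.of_forall fun ω => ?_)
    simp only [indicator_apply, mem_ofPred_eq, hD, Pi.one_apply]
  refine tendsto_nhds_unique (f := fun m => ∫ ω, G m ω ∂P) (l := atTop) ?_ ?_
  -- The sums are dominated by the total count of `N i` on `(0, t]` and, for each `ω`, are
  -- eventually equal to the limit.
  · refine tendsto_integral_of_dominated_convergence (fun ω => (postCount (N i ω) 0 t : ℝ))
      (fun m => (integrable_finsetSum _ (hGterm_int m)).aestronglyMeasurable)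
      ((hN i).integrable_postCount le_rfl ht.le) (fun m => Eventually.of_forall fun ω => ?_)
      (Eventually.of_forall fun ω => ?_)
    · have h := sum_postCount ((hN i).locallyFinite ω t) (hmono m) (ha0 m) (m + 1) (ham m).le
      rw [ham] at h
      rw [Real.norm_of_nonneg (by positivity), ← h, Nat.cast_sum]
      refine Finset.sum_le_sum fun l _ => ?_
      split_ifs <;> simp
    · refine tendsto_const_nhds.congr' ?_
      filter_upwards [eventually_ncard_eq_sum (fun k => N k ω) s hi (n + 1) ht
        fun k _ => (hN k).locallyFinite ω t] with m hm
      rw [hm]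
      push_cast
      simp only [hG, hD, ha]
      push_cast
      rfl
  · simp only [hGint]
    exact hlim

end Superposition

/-! ### The degenerate case `ξ < 1`, and integrability in time. -/

section

variable {n : ℕ} {t T : ℝ} {f g m fA fB : ℝ → ℝ}

theorem visibilityRate_congr (ht : 0 ≤ t) (h : EqOn fA fB (Ioo 0 t)) :
    visibilityRate n t g fA = visibilityRate n t g fB := by
  refine intervalIntegral.integral_congr_Ioo_of_le ht fun x hx => ?_
  rw [h hx, intervalIntegral.integral_congr_Ioo_of_le hx.2.le (h.mono (Ioo_subset_Ioo_left hx.1.le))]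

/-- `visibilityRate_gain_le` without the assumption `1 ≤ ξ`: a function that is `ξ`-bounded for
some `ξ < 1` vanishes. -/
theorem visibilityRate_gain_le' {ξ : ℝ} (ht : 0 < t)
    (hgi : IntervalIntegrable g volume 0 t) (hAi : IntervalIntegrable fA volume 0 t)
    (hBi : IntervalIntegrable fB volume 0 t) (hmi : IntervalIntegrable m volume 0 t)
    (hg : ∀ x ∈ Ioo 0 t, 0 ≤ g x) (hm : ∀ x ∈ Ioo 0 t, 0 ≤ m x)
    (hgA : ∀ x ∈ Ioo 0 t, g x ≤ fA x) (hAB : ∀ x ∈ Ioo 0 t, fA x ≤ fB x)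
    (hgb : XiBounded ξ t g) (hBb : XiBounded ξ t fB)
    (hBmb : XiBounded ξ t (fun x => fB x + m x)) :
    visibilityRate n t g (fun x => fB x + m x) - visibilityRate n t g fB ≤
      ξ ^ 2 * (visibilityRate n t g (fun x => fA x + m x) - visibilityRate n t g fA) := by
  rcases le_or_gt 1 ξ with hξ | hξ
  · exact visibilityRate_gain_le ht hξ hgi hAi hBi hmi hg hm hgA hAB hgb hBb hBmb
  · have hm0 : ∀ x ∈ Ioo 0 t, m x = 0 := by
      intro x hx
      have h1 := hBmb x hx x hx
      have h2 := (hg x hx).trans ((hgA x hx).trans (hAB x hx))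
      have h3 := hm x hx
      nlinarith
    have h : ∀ f : ℝ → ℝ, visibilityRate n t g (fun x => f x + m x) = visibilityRate n t g f :=
      fun f => visibilityRate_congr ht.le fun x hx => by simp [hm0 x hx]
    simp [h]

/-- Fubini on `(0, T]²`: the tail is a difference of continuous primitives, the range `x ≤ t`
becomes an indicator, and the kernel is dominated by `|m x|` because `poissonCDF` lies in `[0, 1]`.
-/
theorem intervalIntegrable_integral_mul_poissonCDF (hT : 0 ≤ T)
    (hf : IntervalIntegrable f volume 0 T) (hf0 : ∀ x ∈ Ioo 0 T, 0 ≤ f x)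
    (hm : IntervalIntegrable m volume 0 T) :
    IntervalIntegrable (fun t => ∫ x in 0..t, m x * poissonCDF n (∫ y in x..t, f y))
      volume 0 T := by
  set ν := volume.restrict (Ioc 0 T) with hν
  have hm' : Integrable m ν := (intervalIntegrable_iff_integrableOn_Ioc_of_le hT).1 hm
  have hΦ : ContinuousOn (fun x => ∫ y in 0..x, f y) (Icc 0 T) := by
    have := intervalIntegral.continuousOn_primitive_interval' hf left_mem_uIcc
    rwa [uIcc_of_le hT] at this
  have hprod : ν.prod ν = (volume.prod volume).restrict (Ioc 0 T ×ˢ Ioc 0 T) :=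
    Measure.prod_restrict _ _
  set H : ℝ × ℝ → ℝ := fun z => m z.2 *
    ({z : ℝ × ℝ | z.2 ≤ z.1}.indicator 1 z *
      poissonCDF n ((∫ y in 0..z.1, f y) - ∫ y in 0..z.2, f y)) with hH
  have hsub : ∀ x ∈ Icc 0 T, ∀ t ∈ Icc 0 T,
      (∫ y in 0..t, f y) - ∫ y in 0..x, f y = ∫ y in x..t, f y := by
    intro x hx t ht
    refine intervalIntegral.integral_interval_sub_left (hf.mono_set ?_) (hf.mono_set ?_) <;>
      exact uIcc_subset_uIcc_left (by rwa [uIcc_of_le hT])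
  have hHm : AEStronglyMeasurable H (ν.prod ν) := by
    refine hm'.aestronglyMeasurable.comp_snd.mul (AEStronglyMeasurable.mul ?_ ?_)
    · exact ((stronglyMeasurable_one).indicator
        (measurableSet_le measurable_snd measurable_fst)).aestronglyMeasurable
    · rw [hprod]
      refine ContinuousOn.aestronglyMeasurable ?_ (measurableSet_Ioc.prod measurableSet_Ioc)
      refine (continuous_poissonCDF n).comp_continuousOn (ContinuousOn.sub ?_ ?_)
      · exact hΦ.comp continuousOn_fst fun z hz => Ioc_subset_Icc_self hz.1
      · exact hΦ.comp continuousOn_snd fun z hz => Ioc_subset_Icc_self hz.2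
  have hHi : Integrable H (ν.prod ν) := by
    refine (hm'.comp_snd ν).mono hHm ?_
    rw [hprod]
    filter_upwards [ae_restrict_mem (measurableSet_Ioc.prod measurableSet_Ioc)] with z hz
    rw [hH, norm_mul]
    refine mul_le_of_le_one_right (norm_nonneg _) ?_
    by_cases hle : z.2 ≤ z.1
    · rw [indicator_of_mem (by exact hle), Pi.one_apply, one_mul,
        hsub _ (Ioc_subset_Icc_self hz.2) _ (Ioc_subset_Icc_self hz.1)]
      have h0 : 0 ≤ ∫ y in z.2..z.1, f y :=
        tail_nonneg (t := z.1) (fun x hx => hf0 x ⟨hx.1, hx.2.trans_le hz.1.2⟩) ⟨hz.2.1.le, hle⟩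
      rw [Real.norm_of_nonneg (poissonCDF_nonneg n h0)]
      exact poissonCDF_le_one n h0
    · rw [indicator_of_notMem (by exact hle)]
      simp
  rw [intervalIntegrable_iff_integrableOn_Ioc_of_le hT]
  refine hHi.integral_prod_left.congr ?_
  filter_upwards [ae_restrict_mem measurableSet_Ioc] with t ht
  rw [intervalIntegral.integral_of_le ht.1.le]
  have hres : volume.restrict (Ioc 0 t) = ν.restrict (Iic t) := by
    rw [hν, Measure.restrict_restrict measurableSet_Iic, inter_comm, Ioc_inter_Iic,
      min_eq_right ht.2]
  rw [hres, ← integral_indicator measurableSet_Iic]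
  refine integral_congr_ae ?_
  filter_upwards [ae_restrict_mem measurableSet_Ioc] with x hx
  simp only [hH, indicator_apply, mem_ofPred_eq, mem_Iic, Pi.one_apply]
  split_ifs
  · rw [hsub x (Ioc_subset_Icc_self hx) t (Ioc_subset_Icc_self ht), one_mul]
  · simp

end

/-! ### Links into a follower as a set of independent sources. -/

section Links

variable {V : Type*} [DecidableEq V]

theorem linksTo_insert_of_ne (S : Finset (V × V)) {v : V × V} {j : V} (h : v.2 ≠ j) :
    linksTo (insert v S) j = linksTo S j := by
  simp [linksTo, Finset.filter_insert, h]

theorem feedIntensity_insert (μ γ : V → ℝ → ℝ) {S : Finset (V × V)} {v : V × V} (h : v ∉ S) :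
    feedIntensity μ γ (insert v S) v.2 = fun x => feedIntensity μ γ S v.2 x + μ v.1 x := by
  ext x
  have : v ∉ linksTo S v.2 := by simp [linksTo, h]
  simp only [feedIntensity]
  rw [show linksTo (insert v S) v.2 = insert v (linksTo S v.2) by
    simp [linksTo, Finset.filter_insert], Finset.sum_insert this]
  ring

theorem feedIntensity_insert_of_ne (μ γ : V → ℝ → ℝ) (S : Finset (V × V)) {v : V × V} {j : V}
    (h : v.2 ≠ j) : feedIntensity μ γ (insert v S) j = feedIntensity μ γ S j := by
  ext x
  simp only [feedIntensity, linksTo_insert_of_ne S h]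

/-- The sources that reach the feed of `j` once the links `S` are added. -/
def activeSources (E' S : Finset (V × V)) (j : V) : Finset (Option {i : V // (i, j) ∈ E'}) :=
  Finset.insertNone (((linksTo S j).image Prod.fst).subtype fun i => (i, j) ∈ E')

theorem mem_of_mem_linksTo {S E' : Finset (V × V)} (hS : S ⊆ E') {j : V} {e : V × V}
    (he : e ∈ linksTo S j) : (e.1, j) ∈ E' := by
  obtain ⟨h1, rfl⟩ := Finset.mem_filter.1 he
  exact hS h1

theorem some_mem_activeSources {S E' : Finset (V × V)} (hS : S ⊆ E') {j : V} {e : V × V}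
    (he : e ∈ linksTo S j) : some ⟨e.1, mem_of_mem_linksTo hS he⟩ ∈ activeSources E' S j := by
  simp only [activeSources, Finset.some_mem_insertNone, Finset.mem_subtype]
  exact Finset.mem_image_of_mem _ he

/-- Among links with the same follower, the broadcaster determines the link, so sums over links and
over sources agree. -/
theorem sum_activeSources {M : Type*} [AddCommMonoid M] {S E' : Finset (V × V)} (hS : S ⊆ E')
    {j : V} (F : Option {i : V // (i, j) ∈ E'} → M) (f : V → M) (hf : ∀ i, F (some i) = f i.1) :
    ∑ k ∈ activeSources E' S j, F k = F none + ∑ e ∈ linksTo S j, f e.1 := by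
  rw [activeSources, Finset.sum_insertNone]
  simp only [hf]
  rw [Finset.sum_subtype_of_mem, Finset.sum_image]
  · intro a ha b hb hab
    exact Prod.ext hab ((Finset.mem_filter.1 ha).2.trans (Finset.mem_filter.1 hb).2.symm)
  · intro i hi
    obtain ⟨e, he, rfl⟩ := Finset.mem_image.1 hi
    exact mem_of_mem_linksTo hS he

end Links

/-! ### Reduction of the average visibility to the visibility functional. -/

section Visibility

variable {V Ω : Type*} [DecidableEq V] [MeasurableSpace Ω] {P : Measure Ω}
  {E' : Finset (V × V)} {post feed : V → Ω → Set ℝ} {μ γ : V → ℝ → ℝ}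

theorem integral_topStories [IsProbabilityMeasure P] {j : V} (hj : j ∈ followers E')
    (hpost : ∀ e ∈ E', IsPoissonProcess P (post e.1) (μ e.1))
    (hfeed : ∀ j ∈ followers E', IsPoissonProcess P (feed j) (γ j))
    (hind : iIndepFun (fun s ω t => countingProcess (sourcesOf post feed E' j s) t ω) P)
    {S : Finset (V × V)} (hS : S ⊆ E') {e : V × V} (he : e ∈ linksTo S j) (n : ℕ) {t : ℝ}
    (ht : 0 < t) :
    ∫ ω, (topStories (n + 1) post feed S e.1 j t ω : ℝ) ∂P =
      ∫ x in 0..t, μ e.1 x * poissonCDF n (∫ y in x..t, feedIntensity μ γ S j y) := by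
  have hN : ∀ k, IsPoissonProcess P (sourcesOf post feed E' j k)
      (k.elim (γ j) fun i => μ i.1) := by
    rintro (_ | i)
    · exact hfeed j hj
    · exact hpost _ i.2
  have h := integral_ncard_followed_lt hN hind _ (some_mem_activeSources hS he) n ht
  have h1 : ∀ τ ω, ∑ k ∈ activeSources E' S j, postCount (sourcesOf post feed E' j k ω) τ t =
      storiesDuring post feed S j τ t ω := fun τ ω =>
    sum_activeSources hS _ (fun i => postCount (post i ω) τ t) fun _ => rfl
  have h2 : ∀ y, ∑ k ∈ activeSources E' S j, (k.elim (γ j) fun i => μ i.1) y =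
      feedIntensity μ γ S j y := fun y =>
    sum_activeSources hS (fun k => (k.elim (γ j) fun i => μ i.1) y) (fun i => μ i y) fun _ => rfl
  simp only [h1, h2] at h
  exact h

theorem intervalIntegrable_feedIntensity {j : V} (hj : j ∈ followers E')
    (hpost : ∀ e ∈ E', IsPoissonProcess P (post e.1) (μ e.1))
    (hfeed : ∀ j ∈ followers E', IsPoissonProcess P (feed j) (γ j))
    {S : Finset (V × V)} (hS : S ⊆ E') {t : ℝ} (ht : 0 ≤ t) :
    IntervalIntegrable (feedIntensity μ γ S j) volume 0 t := by
  convert! (IntervalIntegrable.sum (linksTo S j) fun e he =>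
    (hpost _ (mem_of_mem_linksTo hS he)).intensity_integrable t ht).add
      ((hfeed j hj).intensity_integrable t ht) using 1
  ext x
  simp [feedIntensity, add_comm]

theorem feedIntensity_mono {j : V} (hpost : ∀ e ∈ E', IsPoissonProcess P (post e.1) (μ e.1))
    {A B : Finset (V × V)} (hAB : A ⊆ B) (hB : B ⊆ E') {x : ℝ} (hx : 0 ≤ x) :
    feedIntensity μ γ A j x ≤ feedIntensity μ γ B j x :=
  add_le_add_right (Finset.sum_le_sum_of_subset_of_nonneg (Finset.filter_subset_filter _ hAB)
    fun _ he _ => (hpost _ (mem_of_mem_linksTo hB he)).intensity_nonneg x hx) _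

theorem feedIntensity_empty (j : V) : feedIntensity μ γ ∅ j = γ j := by
  ext x
  simp [feedIntensity, linksTo]

theorem feedIntensity_nonneg {j : V} (hj : j ∈ followers E')
    (hpost : ∀ e ∈ E', IsPoissonProcess P (post e.1) (μ e.1))
    (hfeed : ∀ j ∈ followers E', IsPoissonProcess P (feed j) (γ j))
    {S : Finset (V × V)} (hS : S ⊆ E') {x : ℝ} (hx : 0 ≤ x) : 0 ≤ feedIntensity μ γ S j x :=
  add_nonneg ((hfeed j hj).intensity_nonneg x hx) (Finset.sum_nonneg fun _ he =>
    (hpost _ (mem_of_mem_linksTo hS he)).intensity_nonneg x hx)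

/-- All added links share the factor `poissonCDF n (∫ₓᵗ γ_j^S)`, and their intensities add up to
`γ_j^S - γ_j`. -/
theorem visibilityRate_eq_sum {j : V} (hj : j ∈ followers E')
    (hpost : ∀ e ∈ E', IsPoissonProcess P (post e.1) (μ e.1))
    (hfeed : ∀ j ∈ followers E', IsPoissonProcess P (feed j) (γ j))
    {S : Finset (V × V)} (hS : S ⊆ E') (n : ℕ) {t : ℝ} (ht : 0 ≤ t) :
    visibilityRate n t (γ j) (feedIntensity μ γ S j) = ∑ e ∈ linksTo S j,
      ∫ x in 0..t, μ e.1 x * poissonCDF n (∫ y in x..t, feedIntensity μ γ S j y) := by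
  rw [← intervalIntegral.integral_finsetSum fun e he =>
    ((hpost _ (mem_of_mem_linksTo hS he)).intensity_integrable t ht).mul_continuousOn
      (continuousOn_poissonCDF_tail (intervalIntegrable_feedIntensity hj hpost hfeed hS ht))]
  refine intervalIntegral.integral_congr fun x _ => ?_
  simp only [← Finset.sum_mul]
  congr 1
  simp [feedIntensity]

theorem intervalIntegrable_integral_followed {j : V} (hj : j ∈ followers E')
    (hpost : ∀ e ∈ E', IsPoissonProcess P (post e.1) (μ e.1))
    (hfeed : ∀ j ∈ followers E', IsPoissonProcess P (feed j) (γ j))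
    {S : Finset (V × V)} (hS : S ⊆ E') {e : V × V} (he : e ∈ linksTo S j) (n : ℕ) {t₀ t_f : ℝ}
    (ht₀ : 0 ≤ t₀) (htf : t₀ ≤ t_f) :
    IntervalIntegrable (fun t => ∫ x in 0..t, μ e.1 x *
      poissonCDF n (∫ y in x..t, feedIntensity μ γ S j y)) volume t₀ t_f := by
  have hT := ht₀.trans htf
  refine (intervalIntegrable_integral_mul_poissonCDF hT
    (intervalIntegrable_feedIntensity hj hpost hfeed hS hT)
    (fun x hx => feedIntensity_nonneg hj hpost hfeed hS hx.1.le)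
    ((hpost _ (mem_of_mem_linksTo hS he)).intensity_integrable _ hT)).mono_set ?_
  rw [uIcc_of_le htf, uIcc_of_le hT]
  exact Icc_subset_Icc_left ht₀

theorem intervalIntegrable_visibilityRate {j : V} (hj : j ∈ followers E')
    (hpost : ∀ e ∈ E', IsPoissonProcess P (post e.1) (μ e.1))
    (hfeed : ∀ j ∈ followers E', IsPoissonProcess P (feed j) (γ j))
    {S : Finset (V × V)} (hS : S ⊆ E') (n : ℕ) {t₀ t_f : ℝ}
    (ht₀ : 0 ≤ t₀) (htf : t₀ ≤ t_f) :
    IntervalIntegrable (fun t => visibilityRate n t (γ j) (feedIntensity μ γ S j))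
      volume t₀ t_f := by
  have h := IntervalIntegrable.sum (linksTo S j) fun e he =>
    intervalIntegrable_integral_followed hj hpost hfeed hS he n ht₀ htf
  refine h.congr_uIoo fun t ht => ?_
  rw [uIoo_of_le htf] at ht
  rw [Finset.sum_apply]
  exact (visibilityRate_eq_sum hj hpost hfeed hS n (ht₀.trans ht.1.le)).symm

theorem sum_linkVisibility [IsProbabilityMeasure P] {j : V} (hj : j ∈ followers E')
    (hpost : ∀ e ∈ E', IsPoissonProcess P (post e.1) (μ e.1))
    (hfeed : ∀ j ∈ followers E', IsPoissonProcess P (feed j) (γ j))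
    (hind : iIndepFun (fun s ω t => countingProcess (sourcesOf post feed E' j s) t ω) P)
    {S : Finset (V × V)} (hS : S ⊆ E') (n : ℕ) {t₀ t_f : ℝ}
    (ht₀ : 0 ≤ t₀) (htf : t₀ ≤ t_f) :
    ∑ e ∈ linksTo S j, linkVisibility P (n + 1) t₀ t_f post feed S e.1 j =
      ∫ t in t₀..t_f, visibilityRate n t (γ j) (feedIntensity μ γ S j) := by
  have h1 : ∫ t in t₀..t_f, visibilityRate n t (γ j) (feedIntensity μ γ S j) =
      ∫ t in t₀..t_f, ∑ e ∈ linksTo S j, ∫ x in 0..t, μ e.1 x *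
        poissonCDF n (∫ y in x..t, feedIntensity μ γ S j y) :=
    intervalIntegral.integral_congr_Ioo_of_le htf fun t ht =>
      visibilityRate_eq_sum hj hpost hfeed hS n (ht₀.trans ht.1.le)
  rw [h1, intervalIntegral.integral_finsetSum fun e he =>
    intervalIntegrable_integral_followed hj hpost hfeed hS he n ht₀ htf]
  exact Finset.sum_congr rfl fun e he => intervalIntegral.integral_congr_Ioo_of_le htf
    fun t ht => integral_topStories hj hpost hfeed hind hS he n (ht₀.trans_lt ht.1)

/-- The gain of visibility from one more link, as an integral over the time window. -/
theorem averageVisibility_insert_sub [IsProbabilityMeasure P]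
    (hpost : ∀ e ∈ E', IsPoissonProcess P (post e.1) (μ e.1))
    (hfeed : ∀ j ∈ followers E', IsPoissonProcess P (feed j) (γ j))
    (hind : ∀ j ∈ followers E',
      iIndepFun (fun s ω t => countingProcess (sourcesOf post feed E' j s) t ω) P)
    {S : Finset (V × V)} (hS : S ⊆ E') {v : V × V} (hv : v ∈ E') (hvS : v ∉ S) (n : ℕ)
    {t₀ t_f : ℝ} (ht₀ : 0 ≤ t₀) (htf : t₀ ≤ t_f) :
    averageVisibility P (n + 1) t₀ t_f post feed E' (insert v S) -
        averageVisibility P (n + 1) t₀ t_f post feed E' S =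
      ∫ t in t₀..t_f,
        (visibilityRate n t (γ v.2) (fun x => feedIntensity μ γ S v.2 x + μ v.1 x) -
          visibilityRate n t (γ v.2) (feedIntensity μ γ S v.2)) := by
  have hvS' : insert v S ⊆ E' := Finset.insert_subset hv hS
  have hvf : v.2 ∈ followers E' := Finset.mem_image_of_mem _ hv
  have h1 : ∀ {T}, T ⊆ E' → averageVisibility P (n + 1) t₀ t_f post feed E' T =
      ∑ j ∈ followers E', ∫ t in t₀..t_f, visibilityRate n t (γ j) (feedIntensity μ γ T j) :=
    fun hT => Finset.sum_congr rfl fun j hj =>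
      sum_linkVisibility hj hpost hfeed (hind j hj) hT n ht₀ htf
  -- Only the feed of `v.2` changes; every other follower contributes zero.
  rw [h1 hvS', h1 hS, ← Finset.sum_sub_distrib, Finset.sum_eq_single_of_mem v.2 hvf]
  · rw [← intervalIntegral.integral_sub
      (intervalIntegrable_visibilityRate hvf hpost hfeed hvS' n ht₀ htf)
      (intervalIntegrable_visibilityRate hvf hpost hfeed hS n ht₀ htf),
      feedIntensity_insert μ γ hvS]
  · intro j _ hj
    rw [feedIntensity_insert_of_ne μ γ S hj.symm, sub_self]

/-- Adding a link does not decrease the visibility. -/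
theorem averageVisibility_insert_sub_nonneg [IsProbabilityMeasure P]
    (hpost : ∀ e ∈ E', IsPoissonProcess P (post e.1) (μ e.1))
    (hfeed : ∀ j ∈ followers E', IsPoissonProcess P (feed j) (γ j))
    (hind : ∀ j ∈ followers E',
      iIndepFun (fun s ω t => countingProcess (sourcesOf post feed E' j s) t ω) P)
    {S : Finset (V × V)} (hS : S ⊆ E') {v : V × V} (hv : v ∈ E') (n : ℕ)
    {t₀ t_f : ℝ} (ht₀ : 0 ≤ t₀) (htf : t₀ ≤ t_f) :
    0 ≤ averageVisibility P (n + 1) t₀ t_f post feed E' (insert v S) -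
      averageVisibility P (n + 1) t₀ t_f post feed E' S := by
  by_cases hvS : v ∈ S
  · simp [Finset.insert_eq_of_mem hvS]
  have hvf : v.2 ∈ followers E' := Finset.mem_image_of_mem _ hv
  rw [averageVisibility_insert_sub hpost hfeed hind hS hv hvS n ht₀ htf,
    intervalIntegral.integral_of_le htf, integral_Ioc_eq_integral_Ioo]
  refine setIntegral_nonneg measurableSet_Ioo fun t ht => ?_
  have ht0 : 0 < t := ht₀.trans_lt ht.1
  exact sub_nonneg.2 (visibilityRate_le_add ht0 ((hfeed _ hvf).intensity_integrable t ht0.le)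
    (intervalIntegrable_feedIntensity hvf hpost hfeed hS ht0.le)
    ((hpost v hv).intensity_integrable t ht0.le)
    (fun x hx => (hfeed _ hvf).intensity_nonneg x hx.1.le)
    (fun x hx => (hpost v hv).intensity_nonneg x hx.1.le)
    (fun x hx => feedIntensity_nonneg hvf hpost hfeed hS hx.1.le))

/-- With `ξ`-bounded feed intensities, marginal gains of visibility decrease up to a factor
`ξ ^ 2`. -/
theorem averageVisibility_gain_le [IsProbabilityMeasure P] {ξ t₀ t_f : ℝ}
    (hpost : ∀ e ∈ E', IsPoissonProcess P (post e.1) (μ e.1))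
    (hfeed : ∀ j ∈ followers E', IsPoissonProcess P (feed j) (γ j))
    (hind : ∀ j ∈ followers E',
      iIndepFun (fun s ω t => countingProcess (sourcesOf post feed E' j s) t ω) P)
    (hξ : ∀ j ∈ followers E', ∀ S ⊆ E', XiBounded ξ t_f (feedIntensity μ γ S j))
    {A B : Finset (V × V)} (hAB : A ⊆ B) (hB : B ⊆ E') {v : V × V} (hv : v ∈ E') (n : ℕ)
    (ht₀ : 0 ≤ t₀) (htf : t₀ ≤ t_f) :
    averageVisibility P (n + 1) t₀ t_f post feed E' (insert v B) -
        averageVisibility P (n + 1) t₀ t_f post feed E' B ≤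
      ξ ^ 2 * (averageVisibility P (n + 1) t₀ t_f post feed E' (insert v A) -
        averageVisibility P (n + 1) t₀ t_f post feed E' A) := by
  have hA := hAB.trans hB
  by_cases hvB : v ∈ B
  · rw [Finset.insert_eq_of_mem hvB, sub_self]
    exact mul_nonneg (sq_nonneg ξ)
      (averageVisibility_insert_sub_nonneg hpost hfeed hind hA hv n ht₀ htf)
  have hvA : v ∉ A := fun h => hvB (hAB h)
  have hvf : v.2 ∈ followers E' := Finset.mem_image_of_mem _ hv
  rw [averageVisibility_insert_sub hpost hfeed hind hB hv hvB n ht₀ htf,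
    averageVisibility_insert_sub hpost hfeed hind hA hv hvA n ht₀ htf,
    ← intervalIntegral.integral_const_mul]
  have hint : ∀ {S}, S ⊆ E' → v ∉ S → IntervalIntegrable (fun t =>
      visibilityRate n t (γ v.2) (fun x => feedIntensity μ γ S v.2 x + μ v.1 x) -
        visibilityRate n t (γ v.2) (feedIntensity μ γ S v.2)) volume t₀ t_f := by
    intro S hS hvS
    have h := intervalIntegrable_visibilityRate hvf hpost hfeed (Finset.insert_subset hv hS) n
      ht₀ htf
    rw [feedIntensity_insert μ γ hvS] at h
    exact h.sub (intervalIntegrable_visibilityRate hvf hpost hfeed hS n ht₀ htf)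
  refine intervalIntegral.integral_mono_on_of_le_Ioo htf (hint hB hvB)
    ((hint hA hvA).const_mul _) fun t ht => ?_
  have ht0 : 0 < t := ht₀.trans_lt ht.1
  have hsub : Ioo 0 t ⊆ Ioo 0 t_f := Ioo_subset_Ioo_right ht.2.le
  have hξt : ∀ S ⊆ E', XiBounded ξ t (feedIntensity μ γ S v.2) := fun S hS x hx y hy =>
    hξ _ hvf S hS x (hsub hx) y (hsub hy)
  have hξv := hξt _ (Finset.insert_subset hv hB)
  rw [feedIntensity_insert μ γ hvB] at hξv
  -- With no links added the feed intensity is `γ` itself, which supplies its `ξ`-boundedness.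
  have hξγ := hξt ∅ (Finset.empty_subset _)
  rw [feedIntensity_empty] at hξγ
  refine visibilityRate_gain_le' ht0 ((hfeed _ hvf).intensity_integrable t ht0.le)
    (intervalIntegrable_feedIntensity hvf hpost hfeed hA ht0.le)
    (intervalIntegrable_feedIntensity hvf hpost hfeed hB ht0.le)
    ((hpost v hv).intensity_integrable t ht0.le)
    (fun x hx => (hfeed _ hvf).intensity_nonneg x hx.1.le)
    (fun x hx => (hpost v hv).intensity_nonneg x hx.1.le) (fun x hx => ?_)
    (fun x hx => feedIntensity_mono hpost hAB hB hx.1.le) hξγ (hξt B hB) hξv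
  have h := feedIntensity_mono (γ := γ) (j := v.2) hpost (Finset.empty_subset A) hA hx.1.le
  rwa [feedIntensity_empty] at h

theorem curvatureAtMost_averageVisibility [IsProbabilityMeasure P] {ξ t₀ t_f : ℝ}
    (hpost : ∀ e ∈ E', IsPoissonProcess P (post e.1) (μ e.1))
    (hfeed : ∀ j ∈ followers E', IsPoissonProcess P (feed j) (γ j))
    (hind : ∀ j ∈ followers E',
      iIndepFun (fun s ω t => countingProcess (sourcesOf post feed E' j s) t ω) P)
    (hξ : ∀ j ∈ followers E', ∀ S ⊆ E', XiBounded ξ t_f (feedIntensity μ γ S j))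
    (n : ℕ) (ht₀ : 0 ≤ t₀) (htf : t₀ ≤ t_f) {q : ℝ} (hq0 : 0 ≤ q) (hq1 : q ≤ 1) :
    CurvatureAtMost E' (averageVisibility P (n + 1) t₀ t_f post feed E')
      (1 - 1 / ξ ^ 2 * q) := by
  refine IsAlphaSubmodular.curvatureAtMost (fun v hv A B hAB hB => ?_)
    (sub_le_self _ (by positivity))
  have hA0 := averageVisibility_insert_sub_nonneg hpost hfeed hind (hAB.trans hB) hv n ht₀ htf
  have hB0 := averageVisibility_insert_sub_nonneg hpost hfeed hind hB hv n ht₀ htf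
  have hle := averageVisibility_gain_le hpost hfeed hind hξ hAB hB hv n ht₀ htf
  rw [sub_sub_cancel]
  -- For `ξ = 0` the convention `1 / 0 = 0` reduces the claim to monotonicity.
  rcases eq_or_ne ξ 0 with rfl | hξ0
  · simpa using hA0
  · have hξ2 : 0 < ξ ^ 2 := by positivity
    rw [mul_assoc, one_div_mul_eq_div, div_le_iff₀' hξ2]
    exact (mul_le_of_le_one_left hB0 hq1).trans hle

end Visibility

/-! ### Conclusion. -/

theorem mainTheorem5 (ζ : ℝ) (hζ : 0 < ζ) :
    ∃ c : ℝ, 0 < c ∧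
      ∀ (V : Type*) [DecidableEq V] (Ω : Type*) [MeasurableSpace Ω] (P : Measure Ω)
        [IsProbabilityMeasure P] (E' : Finset (V × V)) (post feed : V → Ω → Set ℝ)
        (μ γ : V → ℝ → ℝ) (K : ℕ) (t₀ t_f ξ ρ : ℝ),
        1 ≤ K → 0 ≤ t₀ → t₀ < t_f → 0 < ρ →
        -- posts and existing feeds are Poisson processes, independent within each feed
        (∀ e ∈ E', IsPoissonProcess P (post e.1) (μ e.1)) →
        (∀ j ∈ followers E', IsPoissonProcess P (feed j) (γ j)) →
        (∀ j ∈ followers E',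
          iIndepFun (fun s ω t => countingProcess (sourcesOf post feed E' j s) t ω) P) →
        -- the feed intensities are `ξ`-bounded
        (∀ j ∈ followers E', ∀ S ⊆ E', XiBounded ξ t_f (feedIntensity μ γ S j)) →
        -- `t₀` is large enough
        (∀ j ∈ followers E',
          ((K : ℝ) - 1) + ζ * √((K : ℝ) - 1) ≤ ∫ x in (0 : ℝ)..t₀, γ j x) →
        -- `μ_i ≤ γ_j / (ρ √(K - 1))` for each candidate link `(i, j)`
        (∀ e ∈ E', ∀ t ∈ Ioo 0 t_f, ρ * √((K : ℝ) - 1) * μ e.1 t ≤ γ e.2 t) →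
        CurvatureAtMost E' (averageVisibility P K t₀ t_f post feed E')
          (1 - c * (1 / ξ ^ 2 * max (1 / √(K : ℝ)) (min ρ 1 * Real.exp (-(1 / ρ ^ 2))))) ∧
        (1 ≤ ρ →
          CurvatureAtMost E' (averageVisibility P K t₀ t_f post feed E')
            (1 - c * (1 / ξ ^ 2))) := by
  -- Both claimed coefficients are `1 / ξ ^ 2` times some `q ∈ [0, 1]`, so `c = 1` works.
  refine ⟨1, one_pos, ?_⟩
  intro V _ Ω _ P _ E' post feed μ γ K t₀ t_f ξ ρ hK ht₀ htf hρ hpost hfeed hind hξ _ _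
  -- With `K = n + 1`, fewer than `K` later stories means at most `n`, hence the distribution
  -- function at `n`.
  obtain ⟨n, rfl⟩ := Nat.exists_eq_add_of_le' hK
  have key : ∀ q : ℝ, 0 ≤ q → q ≤ 1 →
      CurvatureAtMost E' (averageVisibility P (n + 1) t₀ t_f post feed E')
        (1 - 1 / ξ ^ 2 * q) := fun q =>
    curvatureAtMost_averageVisibility hpost hfeed hind hξ n ht₀ htf.le
  refine ⟨?_, fun _ => ?_⟩
  · rw [one_mul]
    refine key _ (le_max_of_le_left (by positivity)) (max_le ?_ ?_)
    · rw [div_le_one (by positivity), Real.one_le_sqrt]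
      exact_mod_cast hK
    · refine mul_le_one₀ (min_le_right _ _) (Real.exp_nonneg _) (Real.exp_le_one_iff.2 ?_)
      exact neg_nonpos.2 (by positivity)
  · simpa using key 1 zero_le_one le_rfl
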